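/- Let $K,n,T\ge 1$ be integers, let $\mathcal X$ be a measurable space and $\mathcal Z=\mathcal X\times\mathbb R$. Let $\ell:\mathbb R\times\mathbb R\to[0,1]$ be a measurable loss function that is $1$-Lipschitz in its first argument for every value of the second. Let $\mathcal F$ be a class of functions $f:\mathbb R^K\to\mathbb R$ with Lipschitz constant at most $L$ (for the Euclidean norm), $L>0$, and let $\mathcal H$ be a class of measurable functions $h:\mathcal X\to\mathbb R^K$ which is pointwise separable: there is a countable $\mathcal H_0\subseteq\mathcal H$ such that every $h\in\mathcal H$ is the pointwise limit of a sequence in $\mathcal H_0$. For $h\in\mathcal H$ and a sample $\mathbf z=((x_1,y_1),\dots,(x_n,y_n))\in\mathcal Z^n$ let $$m(h)_{\mathbf z}=\min_{f\in\mathcal F}\frac1n\sum_{i=1}^n\ell(f(h(x_i)),y_i),$$ assume that the minimum is attained, let $\hat f_{h,\mathbf z}\in\mathcal F$ be a minimizer, chosen so that $\mathbf z\mapsto\hat f_{h,\mathbf z}(v)$ is measurable for every $v\in\mathbb R^K$, and put $a(h)_{\mathbf z}=\hat f_{h,\mathbf z}\circ h$. Let the environment $\eta$ be a probability measure on the set of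 probability measures on $\mathcal Z$. Define the measures $\mu_\eta(S)=\mathbb E_{\mu\sim\eta}[\mu(S)]$ on $\mathcal Z$ and $\rho_\eta(S)=\mathbb E_{\mu\sim\eta}[\mu^n(S)]$ on $\mathcal Z^n$, and the environment risk $$\mathcal E_\eta(h)=\mathbb E_{\mu\sim\eta}\,\mathbb E_{\mathbf Z\sim\mu^n}\,\mathbb E_{(X,Y)\sim\mu}\big[\ell(a(h)_{\mathbf Z}(X),Y)\big].$$ Let $\bar{\mathbf Z}=(\mathbf Z_1,\dots,\mathbf Z_T)\sim\rho_\eta^T$, where $\mathbf Z_t=((X_{t1},Y_{t1}),\dots,(X_{tn},Y_{tn}))$, $\mathbf X_t=(X_{t1},\dots,X_{tn})$ and $\bar{\mathbf X}=(\mathbf X_1,\dots,\mathbf X_T)$. With independent standard normal variables $\gamma_{kti}$, $\gamma_i$, independent of the data, let $$G(\mathcal H(\bar{\mathbf X}))=\mathbb E\Big[\sup_{h\in\mathcal H}\sum_{k=1}^K\sum_{t=1}^T\sum_{i=1}^n\gamma_{kti}h_k(X_{ti})\,\Big|\,\bar{\mathbf X}\Big],\qquad Q'=\sup_{y\in\mathbb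 R^{Kn}\setminus\{0\}}\frac1{\|y\|}\,\mathbb E\sup_{f\in\mathcal F}\sum_{i=1}^n\gamma_if(y_i),$$ where $y=(y_1,\dots,y_n)$ with $y_i\in\mathbb R^K$, and let $\|h(\mathbf X_t)\|=\big(\sum_{i=1}^n\|h(X_{ti})\|^2\big)^{1/2}$. Assume $Q'<\infty$ (this holds, for example, if $f(0)=0$ for all $f\in\mathcal F$). The other suprema and expectations on the right-hand sides below may be infinite, with $0\cdot\infty=0$. Let $\delta\in(0,1)$. (i) With probability at least $1-\delta$ in $\bar{\mathbf Z}\sim\rho_\eta^T$ it holds for every $h\in\mathcal H$ that $$\mathcal E_\eta(h)-\frac1T\sum_{t=1}^Tm(h)_{\mathbf Z_t}\le\frac{\sqrt{2\pi}\,L\,G(\mathcal H(\bar{\mathbf X}))}{T\sqrt n}+\sqrt{2\pi}\,Q'\sup_{h\in\mathcal H}\sqrt{\frac{\mathbb E_{(X,Y)\sim\mu_\eta}\big[\|h(X)\|^2\big]}{n}}+\sqrt{\frac{9\ln(2/\delta)}{2T}}.$$ (ii) With probability at least $1-\delta$ in $\bar{\mathbf Z}\sim\rho_\eta^T$ it holds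 for every $h\in\mathcal H$ that $$\mathcal E_\eta(h)-\frac1T\sum_{t=1}^Tm(h)_{\mathbf Z_t}\le\frac{\sqrt{2\pi}\,L\,G(\mathcal H(\bar{\mathbf X}))}{T\sqrt n}+\frac{\sqrt{2\pi}\,Q'\sum_{t=1}^T\sup_{h\in\mathcal H}\|h(\mathbf X_t)\|}{nT}+\sqrt{\frac{16\ln(4/\delta)}{T}}.$$ In both parts the set of exceptional multisamples has outer measure at most $\delta$. -/

import Mathlib

open MeasureTheory ProbabilityTheory Filter Topology
open scoped ENNReal NNReal

noncomputable section

namespace MTRL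

/-- Observations: pairs of an input and a real label. -/
abbrev Obs (X : Type*) : Type _ := X × ℝ

/-- The representation space `ℝ^K` with its Euclidean norm. -/
abbrev Rep (K : ℕ) : Type := EuclideanSpace ℝ (Fin K)

/-- The expectation, in `[-∞, ∞]`, of an extended real random variable: the expectation of its
positive part minus the expectation of its negative part. -/
def eexpect {Ω : Type*} [MeasurableSpace Ω] (P : Measure Ω) (g : Ω → EReal) : EReal :=
  ((∫⁻ ω, (g ω).toENNReal ∂P : ℝ≥0∞) : EReal) - ((∫⁻ ω, (-g ω).toENNReal ∂P : ℝ≥0∞) : EReal)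

/-- The law of a family of independent standard normal variables indexed by `ι`. -/
def stdNormal (ι : Type*) [Fintype ι] : Measure (ι → ℝ) :=
  Measure.pi fun _ => gaussianReal 0 1

/-- The Gaussian average `G(Y) = 𝔼 sup_{y ∈ Y} ∑ i, γ i * y i` of a set `Y ⊆ ℝ^ι`
(it is `∞` exactly when the nonempty set `Y` is unbounded). -/
def gaussAvg {ι : Type*} [Fintype ι] (Y : Set (ι → ℝ)) : EReal :=
  eexpect (stdNormal ι) fun γ => ⨆ y ∈ Y, ((∑ i, γ i * y i : ℝ) : EReal)

/-- The Euclidean norm of `y = (y_1, …, y_n)` in `(ℝ^K)^n = ℝ^{Kn}`. -/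
def blockNorm {n K : ℕ} (y : Fin n → Rep K) : ℝ :=
  √(∑ i, ‖y i‖ ^ 2)

/-- The set `𝓗(X̄) = {(h_k(x_{ti}))_{kti} : h ∈ 𝓗}`. -/
def repImage {X : Type*} {T n K : ℕ} (H : Set (X → Rep K)) (x : Fin T → Fin n → X) :
    Set (Fin K × Fin T × Fin n → ℝ) :=
  {v | ∃ h ∈ H, v = fun p => h (x p.2.1 p.2.2) p.1}

/-- `Q'(𝓕) = sup_{y ∈ ℝ^{Kn} ∖ {0}} ‖y‖⁻¹ 𝔼 sup_{f ∈ 𝓕} ∑ i, γ i * f (y i)`, in `[0, ∞]`. -/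
def QPrime {K : ℕ} (n : ℕ) (F : Set (Rep K → ℝ)) : EReal :=
  ⨆ (y : Fin n → Rep K) (_ : y ≠ 0),
    (((blockNorm y)⁻¹ : ℝ) : EReal) * gaussAvg {v : Fin n → ℝ | ∃ f ∈ F, v = fun i => f (y i)}

/-- The empirical risk of `f ∘ h` on the sample `z`. -/
def empRisk {X : Type*} {n K : ℕ} (ℓ : ℝ → ℝ → ℝ) (f : Rep K → ℝ) (h : X → Rep K)
    (z : Fin n → Obs X) : ℝ :=
  (1 / (n : ℝ)) * ∑ i, ℓ (f (h (z i).1)) (z i).2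

/-- The minimal empirical risk `m(h)_z` over `f ∈ 𝓕`. -/
def minEmpRisk {X : Type*} {n K : ℕ} (ℓ : ℝ → ℝ → ℝ) (F : Set (Rep K → ℝ)) (h : X → Rep K)
    (z : Fin n → Obs X) : ℝ :=
  ⨅ f : F, empRisk ℓ f.1 h z

/-- `A h z` is a minimizer over `f ∈ 𝓕` of the empirical risk of `f ∘ h` on the sample `z`, for
every representation `h ∈ 𝓗`, and it depends measurably on the sample. -/
structure IsERM {X : Type*} [MeasurableSpace X] {n K : ℕ} (ℓ : ℝ → ℝ → ℝ) (H : Set (X → Rep K))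
    (F : Set (Rep K → ℝ)) (A : (X → Rep K) → (Fin n → Obs X) → (Rep K → ℝ)) : Prop where
  mem : ∀ h ∈ H, ∀ z, A h z ∈ F
  le : ∀ h ∈ H, ∀ z, ∀ f ∈ F, empRisk ℓ (A h z) h z ≤ empRisk ℓ f h z
  measurable : ∀ h ∈ H, ∀ v : Rep K, Measurable fun z => A h z v

/-- The mixture `μ_η(S) = 𝔼_{μ ∼ η} μ(S)` on observations. -/
def mixture {X : Type*} [MeasurableSpace X] (η : Measure (ProbabilityMeasure (Obs X))) :
    Measure (Obs X) :=
  η.bind fun μ => (μ : Measure (Obs X))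

/-- The law `ρ_η(S) = 𝔼_{μ ∼ η} μ^n(S)` of an `n`-sample from a random task. -/
def sampleLaw {X : Type*} [MeasurableSpace X] (η : Measure (ProbabilityMeasure (Obs X)))
    (n : ℕ) : Measure (Fin n → Obs X) :=
  η.bind fun μ => Measure.pi fun _ : Fin n => (μ : Measure (Obs X))

/-- The environment risk `𝓔_η(h) = 𝔼_{μ ∼ η} 𝔼_{Z ∼ μ^n} 𝔼_{(X, Y) ∼ μ} ℓ(a(h)_Z(X), Y)` of the
algorithm `a(h)_Z = (A h Z) ∘ h`. -/
def envRisk {X : Type*} [MeasurableSpace X] {n K : ℕ} (ℓ : ℝ → ℝ → ℝ)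
    (η : Measure (ProbabilityMeasure (Obs X)))
    (A : (X → Rep K) → (Fin n → Obs X) → (Rep K → ℝ)) (h : X → Rep K) : ℝ :=
  ∫ μ : ProbabilityMeasure (Obs X), ∫ z : Fin n → Obs X, ∫ p : Obs X,
    ℓ (A h z (h p.1)) p.2 ∂(μ : Measure (Obs X))
      ∂(Measure.pi fun _ : Fin n => (μ : Measure (Obs X))) ∂η

/-- Pointwise separability: a countable subclass is sequentially dense for pointwise
convergence. -/
def PointwiseSeparable {X : Type*} {K : ℕ} (H : Set (X → Rep K)) : Prop :=
  ∃ H₀ ⊆ H, H₀.Countable ∧ ∀ h ∈ H, ∃ u : ℕ → X → Rep K,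
    (∀ k, u k ∈ H₀) ∧ ∀ x, Tendsto (fun k => u k x) atTop (𝓝 (h x))

end MTRL

end

/-! Write ρ for `sampleLaw η n`. The gap is the sum of two differences: the environment risk minus
the ρ-mean of m(h), and this mean minus the average of m(h) over the T observed samples.

The first difference concerns a single task with h fixed. The minimizer lies in F and its empirical
risk is m(h), so its true risk exceeds m(h) by at most the largest deviation over F. Symmetrization
(`integral_maxDev_le`) turns the mean of that deviation into a Rademacher average of F on the
represented sample (`envRisk_le`), and a Gaussian comparison bounds this average through Q' and the
norm of the represented sample (`predComplexity_le`). Part (i) averages the norm by Cauchy–Schwarz.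
Part (ii) takes the supremum over h first and estimates its mean from the T samples.

The second difference is a uniform deviation over T i.i.d. samples, and symmetrization applies
again. A minimum is stable, so m(h) is L/√n-Lipschitz in the represented sample
(`IsERM.abs_minEmpRisk_sub_le`). It is a nonlinear function of a vector in ℝ^{Kn}, so a vector
contraction is needed: `signs_sum_le_integral` exchanges each random sign for a Gaussian vector at
the cost √(π/2), giving `radAvg_minEmpRisk_le`.

All concentration comes from one use of McDiarmid's inequality, in
`measure_maxDev_sub_radAvg_ge_le`. It is applied to the deviation minus its empirical complexity
terms, so no union bound is needed. Countable dense subclasses of H and F make the suprema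
measurable; pointwise limits recover the full classes. -/

noncomputable section

namespace MTRL

/-! ### Suprema of finite and bounded families of reals -/

lemma abs_ciSup_le_sum {ι : Type*} [Fintype ι] [Nonempty ι] (f : ι → ℝ) :
    |⨆ i, f i| ≤ ∑ i, |f i| := by
  obtain ⟨i, hi⟩ := exists_eq_ciSup_of_finite (f := f)
  rw [← hi]
  exact Finset.single_le_sum (f := fun i => |f i|) (fun j _ => abs_nonneg _) (Finset.mem_univ i)

lemma integrable_ciSup_of_finite {Ω ι : Type*} [MeasurableSpace Ω] {P : Measure Ω} [Fintype ι]
    [Nonempty ι] {f : ι → Ω → ℝ} (hf : ∀ i, Integrable (f i) P) :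
    Integrable (fun ω => ⨆ i, f i ω) P := by
  refine Integrable.mono' (g := fun ω => ∑ i, |f i ω|)
    (integrable_finsetSum _ fun i _ => (hf i).abs) ?_ (ae_of_all _ fun ω => ?_)
  · exact (AEMeasurable.iSup fun i => (hf i).aemeasurable).aestronglyMeasurable
  · exact abs_ciSup_le_sum _

/-! ### Product measures indexed by `Fin (n + 1)` -/

/-- Splitting off the first coordinate drives both inductions below: the contraction and the
exponential moment bound. -/
lemma measurePreserving_cons {Ω : Type*} [MeasurableSpace Ω] (P : Measure Ω) [SigmaFinite P]
    (n : ℕ) :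
    MeasurePreserving (fun p : Ω × (Fin n → Ω) => (Fin.cons p.1 p.2 : Fin (n + 1) → Ω))
      (P.prod (Measure.pi fun _ => P)) (Measure.pi fun _ => P) := by
  have h := (measurePreserving_piFinSuccAbove (fun _ : Fin (n + 1) => P) 0).symm
  convert h using 1
  ext p i
  simp [MeasurableEquiv.piFinSuccAbove_symm_apply, Fin.insertNthEquiv]

lemma integrable_comp_cons {Ω : Type*} [MeasurableSpace Ω] {P : Measure Ω} [SigmaFinite P]
    {n : ℕ} {f : (Fin (n + 1) → Ω) → ℝ} (hf : Integrable f (Measure.pi fun _ => P)) :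
    Integrable (fun p : Ω × (Fin n → Ω) => f (Fin.cons p.1 p.2))
      (P.prod (Measure.pi fun _ => P)) :=
  (measurePreserving_cons P n).integrable_comp_of_integrable hf

lemma integral_comp_cons {Ω : Type*} [MeasurableSpace Ω] {P : Measure Ω} [SigmaFinite P]
    {n : ℕ} {f : (Fin (n + 1) → Ω) → ℝ} (hf : Integrable f (Measure.pi fun _ => P)) :
    ∫ p : Ω × (Fin n → Ω), f (Fin.cons p.1 p.2) ∂(P.prod (Measure.pi fun _ => P))
      = ∫ x, f x ∂(Measure.pi fun _ => P) := by
  have h := measurePreserving_cons P n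
  rw [← h.map_eq, integral_map h.measurable.aemeasurable]
  rw [h.map_eq]; exact hf.aestronglyMeasurable

/-! ### The standard normal law -/

instance {ι : Type*} [Fintype ι] : IsProbabilityMeasure (stdNormal ι) := by
  unfold stdNormal; infer_instance

lemma integrable_eval_stdNormal {ι : Type*} [Fintype ι] (i : ι) :
    Integrable (fun γ : ι → ℝ => γ i) (stdNormal ι) :=
  integrable_eval (μ := fun _ : ι => gaussianReal 0 1) IsGaussian.integrable_id

lemma integrable_sum_stdNormal {ι : Type*} [Fintype ι] (v : ι → ℝ) :
    Integrable (fun γ : ι → ℝ => ∑ i, γ i * v i) (stdNormal ι) :=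
  integrable_finsetSum _ fun i _ => (integrable_eval_stdNormal i).mul_const _

lemma map_neg_stdNormal {ι : Type*} [Fintype ι] :
    MeasurePreserving (fun γ : ι → ℝ => fun i => -γ i) (stdNormal ι) (stdNormal ι) :=
  measurePreserving_pi _ _ fun _ => ⟨measurable_neg, by simp [gaussianReal_map_neg]⟩

/-- The reciprocal of this moment is the factor √(π/2) lost in passing from signs to Gaussian
variables. -/
lemma integral_abs_gaussianReal_one : ∫ x, |x| ∂(gaussianReal 0 1) = √(2 / Real.pi) := by
  rw [integral_gaussianReal_eq_integral_smul one_ne_zero]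
  have h1 : ∀ x : ℝ, gaussianPDFReal 0 1 x • |x|
      = (fun y => (√(2 * Real.pi))⁻¹ * (y ^ (1 : ℝ) * Real.exp (-(1 / 2) * y ^ (2 : ℝ)))) |x| := by
    intro x
    simp [gaussianPDFReal]
    ring_nf
  simp_rw [h1]
  rw [integral_comp_abs (f := fun y => (√(2 * Real.pi))⁻¹ *
    (y ^ (1 : ℝ) * Real.exp (-(1 / 2) * y ^ (2 : ℝ)))), integral_const_mul,
    integral_rpow_mul_exp_neg_mul_rpow (by norm_num) (by norm_num) (by norm_num)]
  norm_num [Real.Gamma_one]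
  have hp := Real.pi_pos
  have h2 : √2 * √2 = 2 := Real.mul_self_sqrt (by norm_num)
  field_simp
  nlinarith [Real.sqrt_pos.2 hp]

lemma map_sum_stdNormal {ι : Type*} [Fintype ι] (v : ι → ℝ) :
    (stdNormal ι).map (fun γ => ∑ i, γ i * v i)
      = (gaussianReal 0 1).map (fun x => √(∑ i, v i ^ 2) * x) := by
  have h := IsGaussian.map_eq_gaussianReal (μ := stdGaussian (EuclideanSpace ℝ ι))
    (innerSL ℝ (WithLp.toLp 2 v))
  rw [variance_dual_stdGaussian, integral_strongDual_stdGaussian, ← map_pi_eq_stdGaussian,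
    Measure.map_map (by fun_prop) (by fun_prop)] at h
  have hv := Finset.sum_nonneg fun i (_ : i ∈ Finset.univ) => sq_nonneg (v i)
  have e1 : (innerSL ℝ (WithLp.toLp 2 v) : EuclideanSpace ℝ ι → ℝ) ∘ WithLp.toLp 2
      = fun γ => ∑ i, γ i * v i := by
    ext γ
    simp [PiLp.inner_apply]
  rw [e1] at h
  rw [stdNormal, h, gaussianReal_map_const_mul]
  congr 1
  · simp
  · refine NNReal.eq ?_
    simp [EuclideanSpace.norm_sq_eq, Real.sq_sqrt hv, hv]

/-- The first absolute moment of a linear form in independent standard normal variables. -/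
lemma sqrt_sum_sq_eq {ι : Type*} [Fintype ι] (v : ι → ℝ) :
    √(∑ i, v i ^ 2) = √(Real.pi / 2) * ∫ γ, |∑ i, γ i * v i| ∂(stdNormal ι) := by
  have h : ∫ γ, |∑ i, γ i * v i| ∂(stdNormal ι) = √(∑ i, v i ^ 2) * √(2 / Real.pi) := by
    rw [← integral_abs_gaussianReal_one, ← integral_const_mul,
      ← integral_map (φ := fun γ : ι → ℝ => ∑ i, γ i * v i) (f := fun x => |x|)
        (integrable_sum_stdNormal v).aemeasurable (by fun_prop), map_sum_stdNormal,
      integral_map (by fun_prop) (by fun_prop)]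
    simp only [abs_mul, abs_of_nonneg (Real.sqrt_nonneg _)]
  rw [h, mul_comm, mul_assoc, ← Real.sqrt_mul (by positivity)]
  have := Real.pi_pos
  rw [show 2 / Real.pi * (Real.pi / 2) = 1 by field_simp]
  simp

/-! ### Rademacher averages and their comparison with Gaussian averages -/

/-- The sign encoded by a Boolean. -/
def sgn (b : Bool) : ℝ := if b then 1 else -1

lemma abs_sgn (b : Bool) : |sgn b| = 1 := by cases b <;> simp [sgn]

/-- The Rademacher average `𝔼 sup_i ∑ t, σ t * a i t` of a family of vectors. -/
def radAvg {ι : Type*} {n : ℕ} (a : ι → Fin n → ℝ) : ℝ :=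
  ((2 : ℝ) ^ n)⁻¹ * ∑ σ : Fin n → Bool, ⨆ i, ∑ t, sgn (σ t) * a i t

lemma sum_signs_succ {n : ℕ} (f : (Fin (n + 1) → Bool) → ℝ) :
    ∑ σ, f σ = ∑ σ : Fin n → Bool, (f (Fin.cons true σ) + f (Fin.cons false σ)) := by
  rw [← (Fin.consEquiv fun _ => Bool).sum_comp, Fintype.sum_prod_type, Finset.sum_add_distrib]
  simp [Fin.consEquiv]

/-- A symmetrized difference is dominated by a Gaussian process with larger increments. -/
lemma half_add_ciSup_le {ι κ : Type*} [Fintype ι] [Nonempty ι] [Fintype κ] (ψ : ι → ℝ)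
    (φ : ι → κ → ℝ) (h : ∀ i j, |ψ i - ψ j| ≤ √(∑ k, (φ i k - φ j k) ^ 2)) (g : ι → ℝ) :
    2⁻¹ * ((⨆ i, (ψ i + g i)) + ⨆ i, (-ψ i + g i)) ≤
      ∫ γ, ⨆ i, (√(Real.pi / 2) * ∑ k, γ k * φ i k + g i) ∂(stdNormal κ) := by
  set c := √(Real.pi / 2)
  have hc : 0 ≤ c := Real.sqrt_nonneg _
  -- With maximizers i and j the left side is half of ψ i - ψ j + g i + g j. The increment is at
  -- most the Euclidean distance of φ i and φ j, which is c times the first absolute moment of a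
  -- Gaussian linear form.
  obtain ⟨i, hi⟩ := exists_eq_ciSup_of_finite (f := fun i => ψ i + g i)
  obtain ⟨j, hj⟩ := exists_eq_ciSup_of_finite (f := fun i => -ψ i + g i)
  set M : (κ → ℝ) → ℝ := fun γ => ⨆ i, (c * ∑ k, γ k * φ i k + g i) with hM
  have hMint : Integrable M (stdNormal κ) :=
    integrable_ciSup_of_finite fun i =>
      ((integrable_sum_stdNormal _).const_mul _).add (integrable_const _)
  have hneg : ∫ γ, M (fun k => -γ k) ∂(stdNormal κ) = ∫ γ, M γ ∂(stdNormal κ) :=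
    map_neg_stdNormal.integral_comp (MeasurableEquiv.neg (κ → ℝ)).measurableEmbedding M
  have hMn : Integrable (fun γ => M (fun k => -γ k)) (stdNormal κ) :=
    map_neg_stdNormal.integrable_comp_of_integrable hMint
  have hle : ∀ γ i, c * ∑ k, γ k * φ i k + g i ≤ M γ := fun γ i =>
    le_ciSup (f := fun i => c * ∑ k, γ k * φ i k + g i) (Set.finite_range _).bddAbove i
  -- According to the sign of the linear form, i is tested at γ and j at -γ, or the reverse. Both
  -- suprema have the same mean because the law is symmetric.
  have hpt : ∀ γ : κ → ℝ, g i + g j + c * |∑ k, γ k * (φ i k - φ j k)|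
      ≤ M γ + M (fun k => -γ k) := by
    intro γ
    have e1 := hle γ i
    have e2 := hle γ j
    have e3 := hle (fun k => -γ k) i
    have e4 := hle (fun k => -γ k) j
    simp only [neg_mul, Finset.sum_neg_distrib, mul_neg] at e3 e4
    simp only [mul_sub, Finset.sum_sub_distrib]
    rcases abs_cases (∑ k, γ k * φ i k - ∑ k, γ k * φ j k) with h | h <;> rw [h.1] <;> nlinarith
  have hint := integral_mono (μ := stdNormal κ)
    ((integrable_const (g i + g j)).add
      ((integrable_sum_stdNormal fun k => φ i k - φ j k).abs.const_mul c)) (hMint.add hMn) hpt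
  simp only [Pi.add_apply] at hint
  rw [integral_add hMint hMn, hneg, integral_add (integrable_const _)
      ((integrable_sum_stdNormal fun k => φ i k - φ j k).abs.const_mul c),
    integral_const_mul, ← sqrt_sum_sq_eq] at hint
  simp only [integral_const, probReal_univ, one_smul] at hint
  have := (le_abs_self _).trans (h i j)
  rw [← hi, ← hj]
  linarith

/-- Vector-valued contraction: a Rademacher process is dominated by `√(π / 2)` times a Gaussian
process with larger increments in each coordinate. -/
lemma signs_sum_le_integral {ι κ : Type*} [Fintype ι] [Nonempty ι] [Fintype κ] {n : ℕ}
    (ψ : ι → Fin n → ℝ) (φ : ι → Fin n → κ → ℝ)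
    (h : ∀ i j t, |ψ i t - ψ j t| ≤ √(∑ k, (φ i t k - φ j t k) ^ 2)) (g : ι → ℝ) :
    ((2 : ℝ) ^ n)⁻¹ * ∑ σ : Fin n → Bool, ⨆ i, (∑ t, sgn (σ t) * ψ i t + g i) ≤
      ∫ γ, ⨆ i, (√(Real.pi / 2) * ∑ t, ∑ k, γ t k * φ i t k + g i)
        ∂(Measure.pi fun _ : Fin n => stdNormal κ) := by
  set c := √(Real.pi / 2)
  -- The offset `g` must vary: it absorbs the signed term ±ψ i 0 while the induction hypothesis
  -- replaces the other signs.
  induction n generalizing g with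
  | zero => simp
  | succ n ih =>
    have hint : ∀ (m : ℕ) (φ : ι → Fin m → κ → ℝ) (g : ι → ℝ), Integrable
        (fun γ : Fin m → κ → ℝ => ⨆ i, (c * ∑ t, ∑ k, γ t k * φ i t k + g i))
        (Measure.pi fun _ : Fin m => stdNormal κ) := fun m φ g =>
      integrable_ciSup_of_finite fun i =>
        ((integrable_finsetSum _ fun t _ =>
          integrable_comp_eval (μ := fun _ : Fin m => stdNormal κ) (i := t)
            (f := fun γ : κ → ℝ => ∑ k, γ k * φ i t k)
            (integrable_sum_stdNormal fun k => φ i t k)).const_mul _).add (integrable_const _)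
    have h1 := hint (n + 1) φ g
    have h2 := integrable_comp_cons h1
    rw [← integral_comp_cons h1, integral_prod_symm _ h2]
    have hs : ∀ s : ℝ, ((2 : ℝ) ^ n)⁻¹ * ∑ σ : Fin n → Bool,
        ⨆ i, (∑ t, sgn (σ t) * ψ i t.succ + (s * ψ i 0 + g i)) ≤ _ := fun s =>
      ih (fun i t => ψ i t.succ) (fun i t => φ i t.succ) (fun i j t => h i j t.succ)
        (fun i => s * ψ i 0 + g i)
    have hL : ((2 : ℝ) ^ (n + 1))⁻¹ * ∑ σ : Fin (n + 1) → Bool,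
          ⨆ i, (∑ t, sgn (σ t) * ψ i t + g i)
        = 2⁻¹ * ((((2 : ℝ) ^ n)⁻¹ * ∑ σ : Fin n → Bool,
              ⨆ i, (∑ t, sgn (σ t) * ψ i t.succ + (1 * ψ i 0 + g i)))
            + (((2 : ℝ) ^ n)⁻¹ * ∑ σ : Fin n → Bool,
              ⨆ i, (∑ t, sgn (σ t) * ψ i t.succ + (-1 * ψ i 0 + g i)))) := by
      rw [sum_signs_succ, Finset.sum_add_distrib, pow_succ, mul_inv]
      have e : ∀ (i : ι) (σ : Fin n → Bool) (b : Bool),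
          ∑ t, sgn ((Fin.cons b σ : Fin (n + 1) → Bool) t) * ψ i t + g i
            = ∑ t, sgn (σ t) * ψ i t.succ + (sgn b * ψ i 0 + g i) := fun i σ b => by
        simp only [Fin.sum_univ_succ, Fin.cons_zero, Fin.cons_succ]
        ring
      simp only [e]
      simp only [sgn, if_true, Bool.false_eq_true, if_false]
      ring
    rw [hL]
    refine (mul_le_mul_of_nonneg_left (add_le_add (hs 1) (hs (-1))) (by norm_num)).trans ?_
    have hi := fun s : ℝ => hint n (fun i t => φ i t.succ) (fun i => s * ψ i 0 + g i)
    rw [← integral_add (hi 1) (hi (-1)), ← integral_const_mul]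
    refine integral_mono (((hi 1).add (hi (-1))).const_mul _) h2.integral_prod_right fun γ => ?_
    -- With the later Gaussian vectors frozen, their contribution becomes the offset, and only the
    -- sign at coordinate 0 remains to be exchanged.
    have key := half_add_ciSup_le (fun i => ψ i 0) (fun i => φ i 0) (fun i j => h i j 0)
      (fun i => c * ∑ t : Fin n, ∑ k, γ t k * φ i t.succ k + g i)
    refine le_trans (le_of_eq ?_) (key.trans (le_of_eq ?_))
    · simp only [one_mul, neg_mul]
      simp only [add_left_comm]
    · simp only [Fin.sum_univ_succ, Fin.cons_zero, Fin.cons_succ, mul_add, add_assoc]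
      rfl

/-- Independent Gaussian blocks form a single Gaussian family. The free index type `τ` accommodates
the index order used in `repImage`. -/
lemma measurePreserving_uncurry_stdNormal {ι κ τ : Type*} [Fintype ι] [Fintype κ] [Fintype τ]
    (e : τ ≃ ι × κ) :
    MeasurePreserving (fun (γ : ι → κ → ℝ) (p : τ) => γ (e p).1 (e p).2)
      (Measure.pi fun _ : ι => stdNormal κ) (stdNormal τ) := by
  have hm : Measurable (fun (γ : ι → κ → ℝ) (p : τ) => γ (e p).1 (e p).2) := by fun_prop
  refine ⟨hm, (Measure.pi_eq fun s hs => ?_).symm⟩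
  rw [Measure.map_apply hm (MeasurableSet.univ_pi hs)]
  have : (fun (γ : ι → κ → ℝ) (p : τ) => γ (e p).1 (e p).2) ⁻¹' Set.univ.pi s
      = Set.univ.pi fun i => Set.univ.pi fun k => s (e.symm (i, k)) := by
    ext γ
    simp only [Set.mem_preimage, Set.mem_univ_pi]
    exact ⟨fun h i k => by simpa using h (e.symm (i, k)),
      fun h p => by simpa using h (e p).1 (e p).2⟩
  rw [this, Measure.pi_pi]
  simp_rw [stdNormal, Measure.pi_pi]
  rw [← Fintype.prod_prod_type', ← e.prod_comp]
  simp

lemma radAvg_le_integral {ι κ τ : Type*} [Fintype ι] [Nonempty ι] [Fintype κ] [Fintype τ] {n : ℕ}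
    (e : τ ≃ Fin n × κ) (ψ : ι → Fin n → ℝ) (φ : ι → τ → ℝ) {b : ℝ} (hb : 0 ≤ b)
    (h : ∀ i j t, |ψ i t - ψ j t| ≤ b * √(∑ k, (φ i (e.symm (t, k)) - φ j (e.symm (t, k))) ^ 2)) :
    radAvg ψ ≤ √(Real.pi / 2) * b * ∫ γ, ⨆ i, ∑ p, γ p * φ i p ∂(stdNormal τ) := by
  -- Scaling the comparison vectors by `b` reduces to Lipschitz constant one; the offset is zero.
  have key := signs_sum_le_integral ψ (fun i t k => b * φ i (e.symm (t, k))) (fun i j t => by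
    refine (h i j t).trans (le_of_eq ?_)
    simp only [← mul_sub, mul_pow, ← Finset.mul_sum]
    rw [Real.sqrt_mul (sq_nonneg b), Real.sqrt_sq hb]) 0
  have hmp := measurePreserving_uncurry_stdNormal e
  have hi : Integrable (fun γ => ⨆ i, ∑ p, γ p * φ i p) (stdNormal τ) :=
    integrable_ciSup_of_finite fun i => integrable_sum_stdNormal (φ i)
  have hmap := integral_map hmp.measurable.aemeasurable
    (by rw [hmp.map_eq]; exact hi.aestronglyMeasurable)
  rw [hmp.map_eq] at hmap
  rw [hmap, ← integral_const_mul]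
  simp only [Pi.zero_apply, add_zero] at key
  refine key.trans (le_of_eq (integral_congr_ae (ae_of_all _ fun γ => ?_)))
  simp only
  rw [Real.mul_iSup_of_nonneg (by positivity)]
  congr 1
  ext i
  rw [← e.symm.sum_comp, Fintype.sum_prod_type]
  simp only [Equiv.apply_symm_apply, mul_assoc, Finset.mul_sum]
  refine Finset.sum_congr rfl fun t _ => Finset.sum_congr rfl fun k _ => by ring

/-! ### Extended expectations and Gaussian averages -/

/-- No measurability is required, since the lower integral is monotone on arbitrary functions. This
permits suprema over uncountable classes in `gaussAvg`. -/
lemma eexpect_mono {Ω : Type*} [MeasurableSpace Ω] {P : Measure Ω} {g g' : Ω → EReal}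
    (h : ∀ ω, g ω ≤ g' ω) : eexpect P g ≤ eexpect P g' := by
  refine EReal.sub_le_sub ?_ ?_ <;> rw [EReal.coe_ennreal_le_coe_ennreal_iff] <;>
    refine lintegral_mono fun ω => EReal.toENNReal_le_toENNReal ?_
  · exact h ω
  · exact EReal.neg_le_neg_iff.2 (h ω)

lemma eexpect_coe {Ω : Type*} [MeasurableSpace Ω] {P : Measure Ω} {f : Ω → ℝ}
    (hf : Integrable f P) : eexpect P (fun ω => (f ω : EReal)) = ((∫ ω, f ω ∂P : ℝ) : EReal) := by
  have h1 : ∫⁻ ω, ENNReal.ofReal (f ω) ∂P ≠ ⊤ := hf.lintegral_lt_top.ne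
  have h2 : ∫⁻ ω, ENNReal.ofReal (-f ω) ∂P ≠ ⊤ := hf.neg.lintegral_lt_top.ne
  simp only [eexpect, ← EReal.coe_neg, EReal.real_coe_toENNReal]
  rw [integral_eq_lintegral_pos_part_sub_lintegral_neg_part hf, EReal.coe_sub,
    EReal.coe_ennreal_toReal h1, EReal.coe_ennreal_toReal h2]

/-- Finite subfamilies give real, integrable lower bounds for a Gaussian average that may be
infinite. -/
lemma integral_ciSup_le_gaussAvg {ι τ : Type*} [Fintype ι] [Nonempty ι] [Fintype τ]
    {φ : ι → τ → ℝ} {Y : Set (τ → ℝ)} (h : ∀ i, φ i ∈ Y) :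
    ((∫ γ, ⨆ i, ∑ p, γ p * φ i p ∂(stdNormal τ) : ℝ) : EReal) ≤ gaussAvg Y := by
  rw [← eexpect_coe (integrable_ciSup_of_finite fun i => integrable_sum_stdNormal (φ i))]
  refine eexpect_mono fun γ => ?_
  obtain ⟨i, hi⟩ := exists_eq_ciSup_of_finite (f := fun i => ∑ p, γ p * φ i p)
  rw [← hi]
  exact le_biSup (fun y : τ → ℝ => ((∑ p, γ p * y p : ℝ) : EReal)) (h i)

lemma gaussAvg_nonneg {τ : Type*} [Fintype τ] {Y : Set (τ → ℝ)} (h : Y.Nonempty) :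
    0 ≤ gaussAvg Y := by
  obtain ⟨y, hy⟩ := h
  have key := integral_ciSup_le_gaussAvg (φ := fun _ : Unit => y) (fun _ => hy)
  have h0 : ∫ γ, ∑ p, γ p * y p ∂(stdNormal τ) = 0 := by
    have e := (map_neg_stdNormal (ι := τ)).integral_comp
      (MeasurableEquiv.neg (τ → ℝ)).measurableEmbedding fun γ => ∑ p, γ p * y p
    simp only [neg_mul, Finset.sum_neg_distrib, integral_neg] at e
    linarith
  simpa [h0] using key

/-! ### Rademacher averages of bounded families -/

lemma abs_sum_sgn_mul_le {n : ℕ} (σ : Fin n → Bool) (a : Fin n → ℝ) :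
    |∑ t, sgn (σ t) * a t| ≤ ∑ t, |a t| := by
  refine (Finset.abs_sum_le_sum_abs _ _).trans (le_of_eq ?_)
  simp [abs_mul, abs_sgn]

lemma bddAbove_sum_sgn {ι : Type*} {n : ℕ} {a : ι → Fin n → ℝ} {C : ℝ}
    (ha : ∀ i t, |a i t| ≤ C) (σ : Fin n → Bool) :
    BddAbove (Set.range fun i => ∑ t, sgn (σ t) * a i t) := by
  refine ⟨n * C, ?_⟩
  rintro _ ⟨i, rfl⟩
  refine ((le_abs_self _).trans (abs_sum_sgn_mul_le σ (a i))).trans ?_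
  exact (Finset.sum_le_sum fun t _ => ha i t).trans (by simp)

lemma average_signs_const {n : ℕ} (x : ℝ) :
    ((2 : ℝ) ^ n)⁻¹ * ∑ _σ : Fin n → Bool, x = x := by
  simp

lemma average_signs_mono {n : ℕ} {f g : (Fin n → Bool) → ℝ} (h : ∀ σ, f σ ≤ g σ) :
    ((2 : ℝ) ^ n)⁻¹ * ∑ σ, f σ ≤ ((2 : ℝ) ^ n)⁻¹ * ∑ σ, g σ :=
  mul_le_mul_of_nonneg_left (Finset.sum_le_sum fun σ _ => h σ) (by positivity)

lemma average_signs_add_const {n : ℕ} (f : (Fin n → Bool) → ℝ) (x : ℝ) :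
    ((2 : ℝ) ^ n)⁻¹ * ∑ σ, (f σ + x) = ((2 : ℝ) ^ n)⁻¹ * ∑ σ, f σ + x := by
  rw [Finset.sum_add_distrib, mul_add, average_signs_const]

/-- The comparison of Rademacher and Gaussian averages for arbitrary bounded families. -/
lemma radAvg_le_gaussAvg {ι κ τ : Type*} [Nonempty ι] [Fintype κ] [Fintype τ] {n : ℕ}
    (e : τ ≃ Fin n × κ) (ψ : ι → Fin n → ℝ) (φ : ι → τ → ℝ) {Y : Set (τ → ℝ)} (hY : ∀ i, φ i ∈ Y)
    {C : ℝ} (hψ : ∀ i t, |ψ i t| ≤ C) {b : ℝ} (hb : 0 ≤ b)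
    (h : ∀ i j t, |ψ i t - ψ j t| ≤ b * √(∑ k, (φ i (e.symm (t, k)) - φ j (e.symm (t, k))) ^ 2)) :
    ((radAvg ψ : ℝ) : EReal) ≤ ((√(Real.pi / 2) * b : ℝ) : EReal) * gaussAvg Y := by
  refine EReal.ge_of_forall_gt_iff_ge.1 fun (z : ℝ) hz => ?_
  have hε : 0 < radAvg ψ - z := sub_pos.2 (EReal.coe_lt_coe_iff.1 hz)
  -- A near-maximizer is chosen for each sign vector, with slack equal to the room above `z`. The
  -- finite family indexed by the sign vectors then carries the whole average up to that slack.
  have hs : ∀ σ : Fin n → Bool, ∃ i, (⨆ i, ∑ t, sgn (σ t) * ψ i t) - (radAvg ψ - z)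
      < ∑ t, sgn (σ t) * ψ i t := fun σ => exists_lt_of_lt_ciSup (by linarith)
  choose s hs using hs
  have h1 : radAvg ψ ≤ radAvg (fun σ => ψ (s σ)) + (radAvg ψ - z) := by
    conv_lhs => unfold radAvg
    unfold radAvg at hs ⊢
    rw [← average_signs_add_const]
    refine average_signs_mono fun σ => ?_
    have := le_ciSup (bddAbove_sum_sgn (fun σ t => hψ (s σ) t) σ) σ
    linarith [hs σ]
  have h2 := radAvg_le_integral e (fun σ => ψ (s σ)) (fun σ => φ (s σ)) hb
    (fun i j t => h _ _ t)
  refine (EReal.coe_le_coe_iff.2 ((by linarith : z ≤ _).trans h2)).trans ?_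
  rw [EReal.coe_mul]
  exact mul_le_mul_of_nonneg_left (integral_ciSup_le_gaussAvg fun σ => hY _)
    (by exact_mod_cast (by positivity : 0 ≤ √(Real.pi / 2) * b))

lemma integral_comp_of_measurable {Ω Ω' : Type*} [MeasurableSpace Ω] [MeasurableSpace Ω']
    {μ : Measure Ω} {ν : Measure Ω'} {φ : Ω → Ω'} (hφ : MeasurePreserving φ μ ν) {f : Ω' → ℝ}
    (hf : Measurable f) : ∫ ω, f (φ ω) ∂μ = ∫ ω', f ω' ∂ν := by
  rw [← hφ.map_eq, integral_map hφ.measurable.aemeasurable hf.aestronglyMeasurable]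

/-! ### Stability of suprema and Rademacher averages -/

lemma abs_ciSup_sub_ciSup_le {ι : Type*} [Nonempty ι] {f g : ι → ℝ} {C : ℝ}
    (hf : BddAbove (Set.range f)) (hg : BddAbove (Set.range g)) (h : ∀ i, |f i - g i| ≤ C) :
    |(⨆ i, f i) - ⨆ i, g i| ≤ C := by
  have h1 : ⨆ i, f i ≤ (⨆ i, g i) + C := ciSup_le fun i => by
    linarith [le_ciSup hg i, (abs_le.1 (h i)).2]
  have h2 : ⨆ i, g i ≤ (⨆ i, f i) + C := ciSup_le fun i => by
    linarith [le_ciSup hf i, (abs_le.1 (h i)).1]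
  rw [abs_le]
  constructor <;> linarith

/-- This stability yields the bounds on Rademacher averages, their bounded differences and their
continuity in the represented inputs. -/
lemma abs_radAvg_sub_radAvg_le {ι : Type*} [Nonempty ι] {n : ℕ} {a a' : ι → Fin n → ℝ} {B C : ℝ}
    (ha : ∀ i t, |a i t| ≤ B) (ha' : ∀ i t, |a' i t| ≤ B)
    (h : ∀ i, ∑ t, |a i t - a' i t| ≤ C) : |radAvg a - radAvg a'| ≤ C := by
  unfold radAvg
  rw [← mul_sub, ← Finset.sum_sub_distrib, abs_mul, abs_of_nonneg (by positivity)]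
  calc _ ≤ ((2 : ℝ) ^ n)⁻¹ * ∑ σ : Fin n → Bool,
        |(⨆ i, ∑ t, sgn (σ t) * a i t) - ⨆ i, ∑ t, sgn (σ t) * a' i t| :=
        mul_le_mul_of_nonneg_left (Finset.abs_sum_le_sum_abs _ _) (by positivity)
    _ ≤ ((2 : ℝ) ^ n)⁻¹ * ∑ σ : Fin n → Bool, C := average_signs_mono fun σ => by
        refine abs_ciSup_sub_ciSup_le (bddAbove_sum_sgn ha σ) (bddAbove_sum_sgn ha' σ) fun i => ?_
        rw [← Finset.sum_sub_distrib]
        simp only [← mul_sub]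
        exact (abs_sum_sgn_mul_le σ fun t => a i t - a' i t).trans (h i)
    _ = C := average_signs_const C

lemma abs_radAvg_le {ι : Type*} [Nonempty ι] {n : ℕ} {a : ι → Fin n → ℝ} {B : ℝ} (hB : 0 ≤ B)
    (ha : ∀ i t, |a i t| ≤ B) : |radAvg a| ≤ n * B := by
  have h := abs_radAvg_sub_radAvg_le (a' := fun (_ : ι) (_ : Fin n) => (0 : ℝ)) (C := n * B) ha
    (fun _ _ => by simpa using hB)
    fun i => (Finset.sum_le_sum fun t _ => by simpa using ha i t).trans (by simp)
  simpa [radAvg] using h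

lemma measurable_radAvg {Ω ι : Type*} [MeasurableSpace Ω] [Countable ι] {n : ℕ}
    {a : ι → Fin n → Ω → ℝ} (ha : ∀ i t, Measurable (a i t)) :
    Measurable fun ω => radAvg fun i t => a i t ω := by
  unfold radAvg
  refine (Finset.measurable_sum _ fun σ _ => Measurable.iSup fun i => ?_).const_mul _
  exact Finset.measurable_sum _ fun t _ => (ha i t).const_mul _

/-! ### Symmetrization -/

/-- The largest deviation of expectations from empirical means over a family of functions. -/
def maxDev {Ω ι : Type*} [MeasurableSpace Ω] {n : ℕ} (P : Measure Ω) (g : ι → Ω → ℝ)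
    (ω : Fin n → Ω) : ℝ :=
  ⨆ i, (∫ x, g i x ∂P - (n : ℝ)⁻¹ * ∑ t, g i (ω t))

lemma abs_mean_le {n : ℕ} {a : Fin n → ℝ} {B : ℝ} (hB : 0 ≤ B) (h : ∀ t, |a t| ≤ B) :
    |(n : ℝ)⁻¹ * ∑ t, a t| ≤ B := by
  rcases Nat.eq_zero_or_pos n with rfl | hn
  · simpa using hB
  · have hn' : (0 : ℝ) < n := by exact_mod_cast hn
    rw [abs_mul, abs_of_nonneg (by positivity), inv_mul_le_iff₀ hn']
    exact (Finset.abs_sum_le_sum_abs _ _).trans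
      ((Finset.sum_le_sum fun t _ => h t).trans (by simp))

section

variable {Ω ι : Type*} [MeasurableSpace Ω] {P : Measure Ω} [IsProbabilityMeasure P]
  {g : ι → Ω → ℝ} {n : ℕ}

lemma abs_integral_le_one {f : Ω → ℝ} (h : ∀ x, |f x| ≤ 1) : |∫ x, f x ∂P| ≤ 1 := by
  have := norm_integral_le_of_norm_le_const (μ := P) (f := f) (C := 1) (ae_of_all _ h)
  simpa using this

lemma abs_dev_le_two (hb : ∀ i x, |g i x| ≤ 1) (ω : Fin n → Ω) (i : ι) :
    |∫ x, g i x ∂P - (n : ℝ)⁻¹ * ∑ t, g i (ω t)| ≤ 2 := by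
  have h1 := abs_integral_le_one (P := P) (hb i)
  have h2 := abs_mean_le zero_le_one fun t => hb i (ω t)
  exact (abs_sub _ _).trans (by linarith)

lemma bddAbove_dev (hb : ∀ i x, |g i x| ≤ 1) (ω : Fin n → Ω) :
    BddAbove (Set.range fun i => ∫ x, g i x ∂P - (n : ℝ)⁻¹ * ∑ t, g i (ω t)) :=
  ⟨2, by rintro _ ⟨i, rfl⟩; exact (le_abs_self _).trans (abs_dev_le_two hb ω i)⟩

lemma abs_maxDev_le [Nonempty ι] (hb : ∀ i x, |g i x| ≤ 1) (ω : Fin n → Ω) :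
    |maxDev P g ω| ≤ 2 := by
  have h := abs_ciSup_sub_ciSup_le (g := fun _ : ι => (0 : ℝ)) (bddAbove_dev (P := P) hb ω)
    ⟨0, by rintro _ ⟨i, rfl⟩; simp⟩ (C := 2) fun i => by simpa using abs_dev_le_two hb ω i
  simpa [maxDev] using h

omit [IsProbabilityMeasure P] in
lemma measurable_maxDev [Countable ι] (hg : ∀ i, Measurable (g i)) :
    Measurable fun ω : Fin n → Ω => maxDev P g ω :=
  Measurable.iSup fun i => (Finset.measurable_sum _ fun t _ =>
    (hg i).comp (measurable_pi_apply t)).const_mul _ |>.const_sub _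

lemma integral_mean_eq (hn : 0 < n) {f : Ω → ℝ} (hf : Integrable f P) :
    ∫ ω : Fin n → Ω, (n : ℝ)⁻¹ * ∑ t, f (ω t) ∂(Measure.pi fun _ => P) = ∫ x, f x ∂P := by
  have hn' : (n : ℝ) ≠ 0 := by exact_mod_cast hn.ne'
  rw [integral_const_mul, integral_finsetSum _ fun t _ => integrable_comp_eval hf]
  simp_rw [integral_comp_eval (μ := fun _ : Fin n => P) hf.aestronglyMeasurable]
  simp [hn']

/-- The largest signed difference of the empirical means of a sample and its ghost sample. -/
def symDev {Ω ι : Type*} {n : ℕ} (g : ι → Ω → ℝ) (σ : Fin n → Bool) (q : Fin n → Ω × Ω) : ℝ :=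
  ⨆ i, (n : ℝ)⁻¹ * ∑ t, sgn (σ t) * (g i (q t).1 - g i (q t).2)

omit [MeasurableSpace Ω] in
lemma abs_symDev_term_le (hb : ∀ i x, |g i x| ≤ 1) (σ : Fin n → Bool) (q : Fin n → Ω × Ω) (i : ι) :
    |(n : ℝ)⁻¹ * ∑ t, sgn (σ t) * (g i (q t).1 - g i (q t).2)| ≤ 2 :=
  abs_mean_le zero_le_two fun t => by
    rw [abs_mul, abs_sgn, one_mul]
    exact (abs_sub _ _).trans (by linarith [hb i (q t).1, hb i (q t).2])

omit [MeasurableSpace Ω] in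
lemma bddAbove_symDev (hb : ∀ i x, |g i x| ≤ 1) (σ : Fin n → Bool) (q : Fin n → Ω × Ω) :
    BddAbove (Set.range fun i => (n : ℝ)⁻¹ * ∑ t, sgn (σ t) * (g i (q t).1 - g i (q t).2)) :=
  ⟨2, by rintro _ ⟨i, rfl⟩; exact (le_abs_self _).trans (abs_symDev_term_le hb σ q i)⟩

omit [MeasurableSpace Ω] in
lemma abs_symDev_le [Nonempty ι] (hb : ∀ i x, |g i x| ≤ 1) (σ : Fin n → Bool)
    (q : Fin n → Ω × Ω) : |symDev g σ q| ≤ 2 := by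
  have h := abs_ciSup_sub_ciSup_le (g := fun _ : ι => (0 : ℝ)) (bddAbove_symDev hb σ q)
    ⟨0, by rintro _ ⟨i, rfl⟩; simp⟩ (C := 2) fun i => by simpa using abs_symDev_term_le hb σ q i
  simpa [symDev] using h

lemma measurable_symDev [Countable ι] (hg : ∀ i, Measurable (g i)) (σ : Fin n → Bool) :
    Measurable (symDev g σ) :=
  Measurable.iSup fun i => by fun_prop

lemma integrable_symDev [Countable ι] [Nonempty ι] (hg : ∀ i, Measurable (g i))
    (hb : ∀ i x, |g i x| ≤ 1) (σ : Fin n → Bool) {μ : Measure (Fin n → Ω × Ω)}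
    [IsProbabilityMeasure μ] : Integrable (symDev g σ) μ :=
  Integrable.of_bound (measurable_symDev hg σ).aestronglyMeasurable 2
    (ae_of_all _ (abs_symDev_le hb σ))

/-- Introduction of a ghost sample. -/
lemma integral_maxDev_le_symDev [Countable ι] [Nonempty ι] (hn : 0 < n)
    (hg : ∀ i, Measurable (g i)) (hb : ∀ i x, |g i x| ≤ 1) :
    ∫ ω : Fin n → Ω, maxDev P g ω ∂(Measure.pi fun _ => P) ≤
      ∫ q, symDev g (fun _ => true) q ∂(Measure.pi fun _ : Fin n => P.prod P) := by
  set Q := Measure.pi fun _ : Fin n => P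
  have hpair := measurePreserving_arrowProdEquivProdArrow Ω Ω (Fin n) (fun _ => P) fun _ => P
  let S : (Fin n → Ω) × (Fin n → Ω) → ℝ := fun p =>
    symDev g (fun _ => true) fun t => (p.1 t, p.2 t)
  have hSm : Measurable S := (measurable_symDev hg _).comp (by fun_prop)
  have hS : Integrable S (Q.prod Q) :=
    Integrable.of_bound hSm.aestronglyMeasurable 2 (ae_of_all _ fun p => abs_symDev_le hb _ _)
  have e : ∫ q, symDev g (fun _ => true) q ∂(Measure.pi fun _ : Fin n => P.prod P)
      = ∫ p, S p ∂(Q.prod Q) :=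
    hpair.integral_comp (MeasurableEquiv.measurableEmbedding _) S
  rw [e, integral_prod_symm _ hS]
  refine integral_mono (Integrable.of_bound (measurable_maxDev hg).aestronglyMeasurable 2
    (ae_of_all _ fun ω => abs_maxDev_le hb ω)) hS.integral_prod_right fun ω => ?_
  -- For a fixed sample ω each deviation is an integral over the ghost sample ω', the first
  -- component of the pair; a supremum of integrals is at most the integral of the supremum.
  refine ciSup_le fun i => ?_
  have hgi : Integrable (g i) P :=
    Integrable.of_bound (hg i).aestronglyMeasurable 1 (ae_of_all _ (hb i))
  have hmean : Integrable (fun ω' : Fin n → Ω => (n : ℝ)⁻¹ * ∑ t, g i (ω' t)) Q :=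
    (integrable_finsetSum _ fun t _ => integrable_comp_eval hgi).const_mul _
  rw [← integral_mean_eq hn hgi]
  have : (n : ℝ)⁻¹ * ∑ t, g i (ω t) = ∫ _ω' : Fin n → Ω, (n : ℝ)⁻¹ * ∑ t, g i (ω t) ∂Q := by simp
  rw [this, ← integral_sub hmean (integrable_const _)]
  refine integral_mono (hmean.sub (integrable_const _)) ?_ fun ω' => ?_
  · exact Integrable.of_bound
      (hSm.comp (measurable_id.prodMk measurable_const)).aestronglyMeasurable 2
      (ae_of_all _ fun p => abs_symDev_le hb _ _)
  · refine le_trans (le_of_eq ?_) (le_ciSup (bddAbove_symDev hb _ _) i)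
    simp [sgn, Finset.sum_sub_distrib, mul_sub]

/-- Exchanging coordinates with the ghost sample. -/
lemma integral_symDev_eq [Countable ι] (hg : ∀ i, Measurable (g i)) (σ : Fin n → Bool) :
    ∫ q, symDev g (fun _ => true) q ∂(Measure.pi fun _ : Fin n => P.prod P)
      = ∫ q, symDev g σ q ∂(Measure.pi fun _ : Fin n => P.prod P) := by
  have hmp : MeasurePreserving
      (fun (q : Fin n → Ω × Ω) t => (if σ t then id else Prod.swap : Ω × Ω → Ω × Ω) (q t))
      (Measure.pi fun _ => P.prod P) (Measure.pi fun _ => P.prod P) :=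
    measurePreserving_pi (fun _ => P.prod P) (fun _ => P.prod P) fun t => by
      split_ifs
      · exact MeasurePreserving.id _
      · exact Measure.measurePreserving_swap
  rw [← integral_comp_of_measurable hmp (measurable_symDev hg _)]
  congr 1
  ext q
  unfold symDev
  congr 1
  ext i
  congr 1
  refine Finset.sum_congr rfl fun t _ => ?_
  rcases h : σ t <;> simp [sgn, h]

-- The supremum of a difference splits into two suprema. Flipping every sign is a bijection of sign
-- vectors and absorbs the minus sign of the second half.
omit [MeasurableSpace Ω] in
lemma average_symDev_le [Nonempty ι] (hb : ∀ i x, |g i x| ≤ 1) (q : Fin n → Ω × Ω) :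
    ((2 : ℝ) ^ n)⁻¹ * ∑ σ, symDev g σ q ≤
      (n : ℝ)⁻¹ * (radAvg (fun i t => g i (q t).1) + radAvg (fun i t => g i (q t).2)) := by
  have hneg : radAvg (fun i t => g i (q t).2)
      = ((2 : ℝ) ^ n)⁻¹ * ∑ σ : Fin n → Bool, ⨆ i, ∑ t, sgn (!σ t) * g i (q t).2 := by
    unfold radAvg
    congr 1
    exact ((Equiv.piCongrRight fun _ : Fin n => Equiv.boolNot).sum_comp
      fun σ : Fin n → Bool => ⨆ i, ∑ t, sgn (σ t) * g i (q t).2).symm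
  rw [hneg, radAvg, ← mul_add, ← Finset.sum_add_distrib, mul_left_comm,
    Finset.mul_sum Finset.univ _ (n : ℝ)⁻¹]
  refine average_signs_mono fun σ => ?_
  refine ciSup_le fun i => mul_le_mul_of_nonneg_left ?_ (by positivity)
  have b1 := le_ciSup (bddAbove_sum_sgn (a := fun i t => g i (q t).1)
    (fun i t => hb i _) σ) i
  have b2 := le_ciSup (bddAbove_sum_sgn (a := fun i t => g i (q t).2)
    (fun i t => hb i _) fun t => !σ t) i
  refine le_trans (le_of_eq ?_) (add_le_add b1 b2)
  rw [← Finset.sum_add_distrib]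
  refine Finset.sum_congr rfl fun t _ => ?_
  cases σ t <;> simp [sgn] <;> ring

lemma measurable_radAvg_comp [Countable ι] (hg : ∀ i, Measurable (g i)) :
    Measurable fun ω : Fin n → Ω => radAvg fun i t => g i (ω t) :=
  measurable_radAvg (a := fun i t (ω : Fin n → Ω) => g i (ω t)) fun i t => by fun_prop

lemma integrable_radAvg_comp [Countable ι] [Nonempty ι] (hg : ∀ i, Measurable (g i))
    (hb : ∀ i x, |g i x| ≤ 1) {μ : Measure (Fin n → Ω)} [IsProbabilityMeasure μ] :
    Integrable (fun ω : Fin n → Ω => radAvg fun i t => g i (ω t)) μ :=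
  Integrable.of_bound (measurable_radAvg_comp hg).aestronglyMeasurable (n * 1)
    (ae_of_all _ fun _ => abs_radAvg_le zero_le_one fun i _ => hb i _)

/-- **Symmetrization**: the expected largest deviation is at most `2 / n` times the expected
Rademacher average. -/
lemma integral_maxDev_le [Countable ι] [Nonempty ι] (hn : 0 < n) (hg : ∀ i, Measurable (g i))
    (hb : ∀ i x, |g i x| ≤ 1) :
    ∫ ω : Fin n → Ω, maxDev P g ω ∂(Measure.pi fun _ => P) ≤
      2 / n * ∫ ω : Fin n → Ω, radAvg (fun i t => g i (ω t)) ∂(Measure.pi fun _ => P) := by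
  have hrp : ∀ (p : Ω × Ω → Ω), MeasurePreserving p (P.prod P) P →
      Integrable (fun q : Fin n → Ω × Ω => radAvg fun i t => g i (p (q t)))
        (Measure.pi fun _ => P.prod P) ∧
      ∫ q : Fin n → Ω × Ω, radAvg (fun i t => g i (p (q t))) ∂(Measure.pi fun _ => P.prod P)
        = ∫ ω : Fin n → Ω, radAvg (fun i t => g i (ω t)) ∂(Measure.pi fun _ => P) := fun p hp => by
    have hmp := measurePreserving_pi (ι := Fin n) (fun _ => P.prod P) (fun _ => P) fun _ => hp
    exact ⟨hmp.integrable_comp_of_integrable (integrable_radAvg_comp hg hb),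
      integral_comp_of_measurable hmp (measurable_radAvg_comp hg)⟩
  obtain ⟨i1, e1⟩ := hrp _ measurePreserving_fst
  obtain ⟨i2, e2⟩ := hrp _ measurePreserving_snd
  calc _ ≤ _ := integral_maxDev_le_symDev hn hg hb
    _ = ((2 : ℝ) ^ n)⁻¹ * ∑ σ : Fin n → Bool,
          ∫ q, symDev g σ q ∂(Measure.pi fun _ => P.prod P) := by
        simp_rw [← integral_symDev_eq hg]
        rw [average_signs_const]
    _ = ∫ q, ((2 : ℝ) ^ n)⁻¹ * ∑ σ : Fin n → Bool, symDev g σ q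
          ∂(Measure.pi fun _ => P.prod P) := by
        rw [integral_const_mul, integral_finsetSum _ fun σ _ => integrable_symDev hg hb σ]
    _ ≤ ∫ q : Fin n → Ω × Ω, (n : ℝ)⁻¹ * (radAvg (fun i t => g i (q t).1)
          + radAvg (fun i t => g i (q t).2)) ∂(Measure.pi fun _ => P.prod P) :=
        integral_mono
          ((integrable_finsetSum _ fun σ _ => integrable_symDev hg hb σ).const_mul _)
          ((i1.add i2).const_mul _) (average_symDev_le hb)
    _ = _ := by
        rw [integral_const_mul, integral_add i1 i2, e1, e2]
        ring

end

/-! ### The bounded difference inequality -/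

/-- Hoeffding's lemma, stated through the oscillation of X because that is what a frozen coordinate
supplies. -/
lemma integral_exp_le_of_diff_le {Ω : Type*} [MeasurableSpace Ω] {P : Measure Ω}
    [IsProbabilityMeasure P] {X : Ω → ℝ} (hX : Measurable X) {c : ℝ}
    (hc : ∀ x y, X x ≤ X y + c) (s : ℝ) :
    ∫ x, Real.exp (s * X x) ∂P ≤ Real.exp (s * ∫ x, X x ∂P + s ^ 2 * c ^ 2 / 8) := by
  obtain ⟨y⟩ := nonempty_of_isProbabilityMeasure P
  have hbdd : BddBelow (Set.range X) := ⟨X y - c, by rintro _ ⟨x, rfl⟩; linarith [hc y x]⟩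
  have : Nonempty Ω := ⟨y⟩
  have hI : ∀ x, X x ∈ Set.Icc (⨅ x, X x) ((⨅ x, X x) + c) := fun x =>
    ⟨ciInf_le hbdd x, by linarith [le_ciInf (f := X) (c := X x - c) fun y => by linarith [hc x y]]⟩
  have h := (hasSubgaussianMGF_of_mem_Icc (μ := P) hX.aemeasurable (ae_of_all _ hI)).mgf_le s
  have e : ∀ x, Real.exp (s * X x) = Real.exp (s * ∫ x, X x ∂P)
      * Real.exp (s * (X x - ∫ x, X x ∂P)) := fun x => by
    rw [← Real.exp_add]; ring_nf
  simp_rw [e]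
  rw [integral_const_mul, Real.exp_add]
  refine mul_le_mul_of_nonneg_left (h.trans (Real.exp_le_exp.2 (le_of_eq ?_))) (Real.exp_pos _).le
  push_cast
  rw [add_sub_cancel_left, Real.norm_eq_abs, div_pow, sq_abs]
  ring

/-- `f` changes by at most `c` when one coordinate of its argument changes. -/
def BoundedDiff {Ω : Type*} {n : ℕ} (f : (Fin n → Ω) → ℝ) (c : ℝ) : Prop :=
  ∀ (t : Fin n) (ω ω' : Fin n → Ω), (∀ s, s ≠ t → ω s = ω' s) → |f ω - f ω'| ≤ c

/-- Integrating out the first coordinate leaves a function of the others that still has differences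
at most c. Hoeffding's lemma in that coordinate costs s²c²/8, and the costs add over n coordinates.
-/
lemma integral_exp_le_of_boundedDiff {Ω : Type*} [MeasurableSpace Ω] {P : Measure Ω}
    [IsProbabilityMeasure P] {n : ℕ} {f : (Fin n → Ω) → ℝ} (hf : Measurable f) {B : ℝ}
    (hB : ∀ ω, |f ω| ≤ B) {c : ℝ} (hc : BoundedDiff f c) (s : ℝ) :
    ∫ ω, Real.exp (s * f ω) ∂(Measure.pi fun _ => P) ≤
      Real.exp (s * ∫ ω, f ω ∂(Measure.pi fun _ => P) + n * (s ^ 2 * c ^ 2 / 8)) := by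
  induction n with
  | zero =>
    simp only [Measure.pi_of_empty _ (default : Fin 0 → Ω), integral_dirac' _ _
      (hf.stronglyMeasurable), integral_dirac' _ _ ((hf.const_mul s).exp.stronglyMeasurable)]
    simp
  | succ n ih =>
    have hfi : Integrable f (Measure.pi fun _ : Fin (n + 1) => P) :=
      Integrable.of_bound hf.aestronglyMeasurable B (ae_of_all _ hB)
    have hebound : ∀ {a : ℝ}, |a| ≤ B → ‖Real.exp (s * a)‖ ≤ Real.exp (|s| * B) := fun {a} ha => by
      rw [Real.norm_eq_abs, abs_of_pos (Real.exp_pos _), Real.exp_le_exp]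
      exact (le_abs_self _).trans (by rw [abs_mul]; gcongr)
    have hei : Integrable (fun ω => Real.exp (s * f ω)) (Measure.pi fun _ : Fin (n + 1) => P) :=
      Integrable.of_bound (hf.const_mul s).exp.aestronglyMeasurable _
        (ae_of_all _ fun ω => hebound (hB ω))
    rw [← integral_comp_cons hei, integral_prod_symm _ (integrable_comp_cons hei),
      ← integral_comp_cons hfi, integral_prod_symm _ (integrable_comp_cons hfi)]
    have hcons : Measurable fun p : Ω × (Fin n → Ω) => (Fin.cons p.1 p.2 : Fin (n + 1) → Ω) :=
      (measurePreserving_cons P n).measurable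
    have hfc : Measurable fun p : Ω × (Fin n → Ω) => f (Fin.cons p.1 p.2) := hf.comp hcons
    set g : (Fin n → Ω) → ℝ := fun ω => ∫ x, f (Fin.cons x ω) ∂P with hg
    have hgm : Measurable g :=
      hfc.stronglyMeasurable.integral_prod_left'.measurable
    have hsec : ∀ ω : Fin n → Ω, Measurable fun x => f (Fin.cons x ω) := fun ω =>
      hfc.comp (measurable_id.prodMk measurable_const)
    have hseci : ∀ ω : Fin n → Ω, Integrable (fun x => f (Fin.cons x ω)) P := fun ω =>
      Integrable.of_bound (hsec ω).aestronglyMeasurable B (ae_of_all _ fun x => hB _)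
    have hgB : ∀ ω, |g ω| ≤ B := fun ω => by
      have := norm_integral_le_of_norm_le_const (μ := P) (f := fun x => f (Fin.cons x ω)) (C := B)
        (ae_of_all _ fun x => hB _)
      simpa using this
    have hgc : BoundedDiff g c := fun t ω ω' h => by
      rw [hg, ← integral_sub (hseci ω) (hseci ω')]
      have := norm_integral_le_of_norm_le_const (μ := P) (C := c)
        (f := fun x => f (Fin.cons x ω) - f (Fin.cons x ω'))
        (ae_of_all _ fun x => hc t.succ _ _ fun s hs => by
          refine Fin.cases ?_ (fun s hs => ?_) s hs
          · intro _; rfl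
          · simpa using h s fun e => hs (by rw [e]))
      simpa using this
    have step : ∀ ω : Fin n → Ω, ∫ x, Real.exp (s * f (Fin.cons x ω)) ∂P
        ≤ Real.exp (s ^ 2 * c ^ 2 / 8) * Real.exp (s * g ω) := fun ω => by
      rw [← Real.exp_add, add_comm (s ^ 2 * c ^ 2 / 8)]
      refine integral_exp_le_of_diff_le (hsec ω) (fun x y => ?_) s
      have := hc 0 (Fin.cons x ω) (Fin.cons y ω) fun s hs => by
        obtain ⟨s, rfl⟩ := Fin.exists_succ_eq.2 hs
        rfl
      linarith [le_abs_self (f (Fin.cons x ω) - f (Fin.cons y ω))]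
    refine (integral_mono (integrable_comp_cons hei).integral_prod_right
      (Integrable.const_mul (Integrable.of_bound (hgm.const_mul s).exp.aestronglyMeasurable _
        (ae_of_all _ fun ω => hebound (hgB ω))) _) step).trans ?_
    rw [integral_const_mul]
    refine (mul_le_mul_of_nonneg_left (ih hgm hgB hgc) (Real.exp_pos _).le).trans (le_of_eq ?_)
    rw [← Real.exp_add]
    push_cast
    ring_nf

/-- **McDiarmid's inequality**. -/
theorem measure_ge_le_of_boundedDiff {Ω : Type*} [MeasurableSpace Ω] {P : Measure Ω}
    [IsProbabilityMeasure P] {n : ℕ} {f : (Fin n → Ω) → ℝ} (hf : Measurable f) {B : ℝ}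
    (hB : ∀ ω, |f ω| ≤ B) {c : ℝ} (hc : BoundedDiff f c) {ε : ℝ} (hε : 0 ≤ ε) :
    (Measure.pi fun _ : Fin n => P).real {ω | ε ≤ f ω - ∫ ω, f ω ∂(Measure.pi fun _ => P)}
      ≤ Real.exp (-ε ^ 2 / (2 * (n * c ^ 2 / 4))) := by
  set Q := Measure.pi fun _ : Fin n => P
  set m := ∫ ω, f ω ∂Q
  -- The variance proxy is nc²/4 because n s²c²/8 = (nc²/4) s²/2.
  have h : HasSubgaussianMGF (fun ω => f ω - m) (⟨n * c ^ 2 / 4, by positivity⟩ : ℝ≥0) Q := by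
    refine ⟨fun s => ?_, fun s => ?_⟩
    · refine Integrable.of_bound ((hf.sub_const m).const_mul s).exp.aestronglyMeasurable
        (Real.exp (|s| * (B + |m|))) (ae_of_all _ fun ω => ?_)
      rw [Real.norm_eq_abs, abs_of_pos (Real.exp_pos _), Real.exp_le_exp]
      refine (le_abs_self _).trans ?_
      rw [abs_mul]
      gcongr
      exact (abs_sub _ _).trans (by linarith [hB ω])
    · have e : ∀ ω, Real.exp (s * (f ω - m)) = Real.exp (-(s * m)) * Real.exp (s * f ω) :=
        fun ω => by rw [← Real.exp_add]; ring_nf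
      simp only [mgf, e]
      rw [integral_const_mul]
      refine (mul_le_mul_of_nonneg_left (integral_exp_le_of_boundedDiff hf hB hc s)
        (Real.exp_pos _).le).trans (le_of_eq ?_)
      rw [← Real.exp_add]
      congr 1
      change _ = n * c ^ 2 / 4 * s ^ 2 / 2
      ring
  exact h.measure_ge_le hε

lemma BoundedDiff.add {Ω : Type*} {n : ℕ} {f g : (Fin n → Ω) → ℝ} {c d : ℝ}
    (hf : BoundedDiff f c) (hg : BoundedDiff g d) : BoundedDiff (fun ω => f ω + g ω) (c + d) :=
  fun t ω ω' h => by
    rw [add_sub_add_comm]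
    exact (abs_add_le _ _).trans (add_le_add (hf t ω ω' h) (hg t ω ω' h))

lemma BoundedDiff.const_mul {Ω : Type*} {n : ℕ} {f : (Fin n → Ω) → ℝ} {c : ℝ}
    (hf : BoundedDiff f c) (a : ℝ) : BoundedDiff (fun ω => a * f ω) (|a| * c) :=
  fun t ω ω' h => by
    rw [← mul_sub, abs_mul]
    exact mul_le_mul_of_nonneg_left (hf t ω ω' h) (abs_nonneg a)

lemma sum_abs_sub_eq {Ω : Type*} {n : ℕ} (V : Ω → ℝ) {t : Fin n} {ω ω' : Fin n → Ω}
    (h : ∀ s, s ≠ t → ω s = ω' s) : ∑ s, |V (ω s) - V (ω' s)| = |V (ω t) - V (ω' t)| :=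
  Finset.sum_eq_single t (fun s _ hs => by simp [h s hs]) (by simp)

lemma boundedDiff_sum {Ω : Type*} (n : ℕ) {V : Ω → ℝ} {v : ℝ} (hV : ∀ x y, |V x - V y| ≤ v) :
    BoundedDiff (fun ω : Fin n → Ω => ∑ t, V (ω t)) v := fun t ω ω' h => by
  rw [← Finset.sum_sub_distrib]
  refine (Finset.abs_sum_le_sum_abs _ _).trans ?_
  rw [sum_abs_sub_eq V h]
  exact hV _ _

section

variable {Ω ι : Type*} [MeasurableSpace Ω] {P : Measure Ω} [IsProbabilityMeasure P]
  {g : ι → Ω → ℝ}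

lemma boundedDiff_maxDev [Nonempty ι] (n : ℕ) (hb : ∀ i x, g i x ∈ Set.Icc (0 : ℝ) 1) :
    BoundedDiff (fun ω : Fin n → Ω => maxDev P g ω) (n : ℝ)⁻¹ := fun t ω ω' h => by
  have hb' : ∀ i x, |g i x| ≤ 1 := fun i x => abs_le.2 ⟨by linarith [(hb i x).1], (hb i x).2⟩
  refine abs_ciSup_sub_ciSup_le (bddAbove_dev hb' ω) (bddAbove_dev hb' ω') fun i => ?_
  have h1 : ∀ x y, |g i x - g i y| ≤ 1 := fun x y =>
    abs_le.2 ⟨by linarith [(hb i x).1, (hb i y).2], by linarith [(hb i y).1, (hb i x).2]⟩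
  rw [sub_sub_sub_cancel_left, abs_sub_comm]
  have := (boundedDiff_sum n h1).const_mul (n : ℝ)⁻¹ t ω ω' h
  simpa using this

omit [MeasurableSpace Ω] in
lemma boundedDiff_radAvg [Nonempty ι] (n : ℕ) (hb : ∀ i x, g i x ∈ Set.Icc (0 : ℝ) 1) :
    BoundedDiff (fun ω : Fin n → Ω => radAvg fun i t => g i (ω t)) 1 := fun t ω ω' h => by
  have hb' : ∀ i x, |g i x| ≤ 1 := fun i x => abs_le.2 ⟨by linarith [(hb i x).1], (hb i x).2⟩
  refine abs_radAvg_sub_radAvg_le (fun i t => hb' i _) (fun i t => hb' i _) fun i => ?_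
  rw [sum_abs_sub_eq (g i) h]
  exact abs_le.2 ⟨by linarith [(hb i (ω t)).1, (hb i (ω' t)).2],
    by linarith [(hb i (ω' t)).1, (hb i (ω t)).2]⟩

/-- A uniform deviation bound for a countable family of `[0, 1]`-valued functions in terms of the
empirical Rademacher average, together with a deviation bound for one further function. -/
theorem measure_maxDev_sub_radAvg_ge_le [Countable ι] [Nonempty ι] {T : ℕ} (hT : 0 < T)
    (hg : ∀ i, Measurable (g i)) (hb : ∀ i x, g i x ∈ Set.Icc (0 : ℝ) 1)
    {V : Ω → ℝ} (hV : Measurable V) {B : ℝ} (hVB : ∀ x, |V x| ≤ B) {v : ℝ}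
    (hv : ∀ x y, |V x - V y| ≤ v) {ε : ℝ} (hε : 0 ≤ ε) :
    (Measure.pi fun _ : Fin T => P).real {ω | ε ≤ maxDev P g ω
        - 2 / T * radAvg (fun i t => g i (ω t)) - (T : ℝ)⁻¹ * ∑ t, V (ω t) + ∫ x, V x ∂P}
      ≤ Real.exp (-(2 * T * ε ^ 2 / (3 + v) ^ 2)) := by
  have hT' : (0 : ℝ) < T := by exact_mod_cast hT
  have hb' : ∀ i x, |g i x| ≤ 1 := fun i x => abs_le.2 ⟨by linarith [(hb i x).1], (hb i x).2⟩
  obtain ⟨x₀⟩ := nonempty_of_isProbabilityMeasure P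
  have hB : 0 ≤ B := (abs_nonneg _).trans (hVB x₀)
  set Q := Measure.pi fun _ : Fin T => P
  set Φ : (Fin T → Ω) → ℝ := fun ω => maxDev P g ω + -(2 / T) * radAvg (fun i t => g i (ω t))
    + -(T : ℝ)⁻¹ * ∑ t, V (ω t) with hΦ
  have hDi : Integrable (fun ω : Fin T → Ω => maxDev P g ω) Q :=
    Integrable.of_bound (measurable_maxDev hg).aestronglyMeasurable 2
      (ae_of_all _ fun ω => abs_maxDev_le hb' ω)
  have hRi : Integrable (fun ω : Fin T → Ω => radAvg fun i t => g i (ω t)) Q :=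
    integrable_radAvg_comp hg hb'
  have hVi : Integrable V P := Integrable.of_bound hV.aestronglyMeasurable B (ae_of_all _ hVB)
  have hVs : Integrable (fun ω : Fin T → Ω => (T : ℝ)⁻¹ * ∑ t, V (ω t)) Q :=
    (integrable_finsetSum _ fun t _ => integrable_comp_eval hVi).const_mul _
  have hΦm : Measurable Φ := by
    refine ((measurable_maxDev hg).add ((measurable_radAvg_comp hg).const_mul _)).add ?_
    fun_prop
  have hΦB : ∀ ω, |Φ ω| ≤ 2 + |-(2 / (T : ℝ))| * (T * 1) + B := fun ω => by
    refine (abs_add_le _ _).trans (add_le_add ((abs_add_le _ _).trans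
      (add_le_add (abs_maxDev_le hb' ω) ?_)) ?_)
    · rw [abs_mul]
      exact mul_le_mul_of_nonneg_left (abs_radAvg_le zero_le_one fun i t => hb' i _) (abs_nonneg _)
    · rw [neg_mul, abs_neg]
      exact abs_mean_le hB fun t => hVB _
  -- One changed sample moves the deviation by 1/T, the Rademacher term by 2/T and the mean of V by
  -- v/T.
  have hΦc : BoundedDiff Φ ((3 + v) / T) := by
    have h := ((boundedDiff_maxDev (P := P) T hb).add
      ((boundedDiff_radAvg T hb).const_mul (-(2 / (T : ℝ))))).add
      ((boundedDiff_sum T hv).const_mul (-(T : ℝ)⁻¹))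
    convert h using 1
    rw [abs_neg, abs_neg, abs_of_pos (by positivity), abs_of_pos (by positivity)]
    field_simp
    ring
  -- Symmetrization makes the expected deviation no larger than the expected Rademacher term, so
  -- only the mean of V survives.
  have hmean : ∫ ω, Φ ω ∂Q ≤ -∫ x, V x ∂P := by
    have h1 := integral_maxDev_le (P := P) hT hg hb'
    have h2 := integral_mean_eq hT hVi
    have e : ∫ ω, Φ ω ∂Q = ∫ ω, maxDev P g ω ∂Q
        + -(2 / T) * ∫ ω : Fin T → Ω, radAvg (fun i t => g i (ω t)) ∂Q
        + -∫ ω : Fin T → Ω, (T : ℝ)⁻¹ * ∑ t, V (ω t) ∂Q := by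
      have hVn : Integrable (fun ω : Fin T → Ω => -(T : ℝ)⁻¹ * ∑ t, V (ω t)) Q := by
        simp only [neg_mul]
        exact hVs.neg
      have s1 := integral_add (hDi.add (hRi.const_mul (-(2 / (T : ℝ))))) hVn
      have s2 := integral_add hDi (hRi.const_mul (-(2 / (T : ℝ))))
      simp only [Pi.add_apply] at s1
      rw [s2, integral_const_mul] at s1
      rw [s1, ← integral_neg]
      simp only [neg_mul]
    rw [e, h2]
    linarith
  refine (measureReal_mono fun ω hω => ?_).trans
    ((measure_ge_le_of_boundedDiff hΦm hΦB hΦc hε).trans (Real.exp_le_exp.2 (le_of_eq ?_)))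
  · simp only [Set.mem_ofPred_eq, hΦ] at hω hmean ⊢
    linarith
  · have h3 : 0 < 3 + v := by linarith [(abs_nonneg _).trans (hv x₀ x₀)]
    field_simp
    ring

/-- Pointwise limits of a family do not deviate more than the family itself. -/
lemma dev_le_maxDev_of_tendsto {n : ℕ} (hg : ∀ i, Measurable (g i))
    (hb : ∀ i x, |g i x| ≤ 1) {u : ℕ → ι} {g' : Ω → ℝ}
    (hu : ∀ x, Tendsto (fun k => g (u k) x) atTop (𝓝 (g' x))) (ω : Fin n → Ω) :
    ∫ x, g' x ∂P - (n : ℝ)⁻¹ * ∑ t, g' (ω t) ≤ maxDev P g ω := by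
  refine le_of_tendsto' (Tendsto.sub ?_ (Tendsto.const_mul _
    (tendsto_finsetSum _ fun t _ => hu (ω t)))) fun k => le_ciSup (bddAbove_dev hb ω) (u k)
  exact tendsto_integral_of_dominated_convergence (fun _ => 1)
    (fun k => (hg (u k)).aestronglyMeasurable) (integrable_const _)
    (fun k => ae_of_all _ fun x => by simpa using hb (u k) x) (ae_of_all _ hu)

end

/-! ### Classes of continuous functions are pointwise separable -/

/-- The space C(ℝ^K, ℝ) is second countable, hence so is every subset, and evaluation at a point is
continuous. -/
lemma exists_countable_pointwise_dense {K : ℕ} {F : Set (Rep K → ℝ)}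
    (hF : ∀ f ∈ F, Continuous f) :
    ∃ F₀ ⊆ F, F₀.Countable ∧ ∀ f ∈ F, ∃ u : ℕ → Rep K → ℝ,
      (∀ k, u k ∈ F₀) ∧ ∀ v, Tendsto (fun k => u k v) atTop (𝓝 (f v)) := by
  have : SecondCountableTopology {φ : C(Rep K, ℝ) // (φ : Rep K → ℝ) ∈ F} :=
    TopologicalSpace.Subtype.secondCountableTopology {φ : C(Rep K, ℝ) | (φ : Rep K → ℝ) ∈ F}
  obtain ⟨s, hs, hsc⟩ := TopologicalSpace.exists_countable_dense
    {φ : C(Rep K, ℝ) // (φ : Rep K → ℝ) ∈ F}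
  refine ⟨(fun φ : {φ : C(Rep K, ℝ) // (φ : Rep K → ℝ) ∈ F} => (φ.1 : Rep K → ℝ)) '' s, ?_,
    hs.image _, fun f hf => ?_⟩
  · rintro _ ⟨φ, -, rfl⟩
    exact φ.2
  · obtain ⟨x, hx, hlim⟩ := mem_closure_iff_seq_limit.1
      (hsc (⟨⟨f, hF f hf⟩, hf⟩ : {φ : C(Rep K, ℝ) // (φ : Rep K → ℝ) ∈ F}))
    refine ⟨fun k => (x k).1, fun k => ⟨x k, hx k, rfl⟩, fun v => ?_⟩
    have hc : Continuous fun φ : {φ : C(Rep K, ℝ) // (φ : Rep K → ℝ) ∈ F} => φ.1 v :=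
      (continuous_eval_const v).comp continuous_subtype_val
    exact (hc.tendsto _).comp hlim

/-! ### The loss -/

section Loss

variable {ℓ : ℝ → ℝ → ℝ} {K : ℕ} {L : ℝ≥0}

lemma measurable_uncurry_loss (hlip : ∀ y, LipschitzWith 1 fun u => ℓ u y)
    (hmeas : ∀ u, Measurable (ℓ u)) : Measurable (Function.uncurry ℓ) :=
  measurable_uncurry_of_continuous_of_measurable (fun y => (hlip y).continuous) hmeas

lemma abs_loss_sub_le (hlip : ∀ y, LipschitzWith 1 fun u => ℓ u y) (u u' y : ℝ) :
    |ℓ u y - ℓ u' y| ≤ |u - u'| := by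
  simpa [Real.dist_eq] using (hlip y).dist_le_mul u u'

lemma abs_loss_comp_sub_le (hlip : ∀ y, LipschitzWith 1 fun u => ℓ u y) {f : Rep K → ℝ}
    (hf : LipschitzWith L f) (v v' : Rep K) (y : ℝ) :
    |ℓ (f v) y - ℓ (f v') y| ≤ L * ‖v - v'‖ :=
  (abs_loss_sub_le hlip _ _ y).trans (by
    simpa [Real.dist_eq, dist_eq_norm] using hf.dist_le_mul v v')

lemma abs_loss_le (hrange : ∀ u y, ℓ u y ∈ Set.Icc (0 : ℝ) 1) (u y : ℝ) : |ℓ u y| ≤ 1 :=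
  abs_le.2 ⟨by linarith [(hrange u y).1], (hrange u y).2⟩

end Loss

lemma sum_norm_le_sqrt_mul {E : Type*} [SeminormedAddCommGroup E] {n : ℕ} (a : Fin n → E) :
    ∑ i, ‖a i‖ ≤ √n * √(∑ i, ‖a i‖ ^ 2) := by
  rw [← Real.sqrt_mul (Nat.cast_nonneg n)]
  refine Real.le_sqrt_of_sq_le ?_
  simpa using sq_sum_le_card_mul_sum_sq (s := Finset.univ) (f := fun i => ‖a i‖)

/-! ### Minimal empirical risks -/

section EmpRisk

variable {X : Type*} {n K : ℕ} {ℓ : ℝ → ℝ → ℝ} {L : ℝ≥0} {F : Set (Rep K → ℝ)}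

lemma empRisk_mem_Icc (hrange : ∀ u y, ℓ u y ∈ Set.Icc (0 : ℝ) 1) (f : Rep K → ℝ)
    (h : X → Rep K) (z : Fin n → Obs X) : empRisk ℓ f h z ∈ Set.Icc (0 : ℝ) 1 := by
  have h1 := abs_mean_le (a := fun i => ℓ (f (h (z i).1)) (z i).2) zero_le_one fun i =>
    abs_loss_le hrange _ _
  simp only [empRisk, one_div]
  exact ⟨mul_nonneg (by positivity) (Finset.sum_nonneg fun i _ => (hrange _ _).1),
    (abs_le.1 h1).2⟩

/-- Cauchy–Schwarz bounds the sum of n norms by √n times the Euclidean norm; the prefactor 1/n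
leaves 1/√n. -/
lemma abs_empRisk_sub_le (hlip : ∀ y, LipschitzWith 1 fun u => ℓ u y) {f : Rep K → ℝ}
    (hf : LipschitzWith L f) (h h' : X → Rep K) (z : Fin n → Obs X) :
    |empRisk ℓ f h z - empRisk ℓ f h' z| ≤ L / √n * √(∑ i, ‖h (z i).1 - h' (z i).1‖ ^ 2) := by
  have hsum : |∑ i, (ℓ (f (h (z i).1)) (z i).2 - ℓ (f (h' (z i).1)) (z i).2)|
      ≤ L * (√n * √(∑ i, ‖h (z i).1 - h' (z i).1‖ ^ 2)) := by
    refine (Finset.abs_sum_le_sum_abs _ _).trans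
      ((Finset.sum_le_sum fun i _ => abs_loss_comp_sub_le hlip hf _ _ _).trans ?_)
    rw [← Finset.mul_sum]
    exact mul_le_mul_of_nonneg_left (sum_norm_le_sqrt_mul _) L.2
  rw [empRisk, empRisk, ← mul_sub, ← Finset.sum_sub_distrib, abs_mul,
    abs_of_nonneg (by positivity)]
  refine (mul_le_mul_of_nonneg_left hsum (by positivity)).trans (le_of_eq ?_)
  rcases Nat.eq_zero_or_pos n with rfl | hn
  · simp
  · have hn' : (0 : ℝ) < √n := Real.sqrt_pos.2 (by exact_mod_cast hn)
    have : (n : ℝ) = √n * √n := (Real.mul_self_sqrt (Nat.cast_nonneg n)).symm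
    rw [this]
    field_simp
    rw [Real.sqrt_sq hn'.le]
    ring

variable [MeasurableSpace X] {H : Set (X → Rep K)}
  {A : (X → Rep K) → (Fin n → Obs X) → (Rep K → ℝ)}

lemma IsERM.minEmpRisk_eq (hA : IsERM ℓ H F A) {h : X → Rep K} (hh : h ∈ H)
    (z : Fin n → Obs X) : minEmpRisk ℓ F h z = empRisk ℓ (A h z) h z := by
  have hne : Nonempty F := ⟨⟨_, hA.mem h hh z⟩⟩
  have hle : ∀ f : F, empRisk ℓ (A h z) h z ≤ empRisk ℓ f.1 h z := fun f => hA.le h hh z f.1 f.2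
  refine le_antisymm ?_ (le_ciInf hle)
  exact ciInf_le (f := fun f : F => empRisk ℓ f.1 h z)
    ⟨_, by rintro _ ⟨f, rfl⟩; exact hle f⟩ ⟨A h z, hA.mem h hh z⟩

/-- The minimizer for either representation competes for the other, so the minima differ by no more
than the risks of a common f. -/
lemma IsERM.abs_minEmpRisk_sub_le (hA : IsERM ℓ H F A)
    (hlip : ∀ y, LipschitzWith 1 fun u => ℓ u y) (hF : ∀ f ∈ F, LipschitzWith L f)
    {h h' : X → Rep K} (hh : h ∈ H) (hh' : h' ∈ H) (z : Fin n → Obs X) :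
    |minEmpRisk ℓ F h z - minEmpRisk ℓ F h' z|
      ≤ L / √n * √(∑ i, ‖h (z i).1 - h' (z i).1‖ ^ 2) := by
  rw [hA.minEmpRisk_eq hh, hA.minEmpRisk_eq hh', abs_le]
  have h1 := hA.le h hh z _ (hA.mem h' hh' z)
  have h2 := hA.le h' hh' z _ (hA.mem h hh z)
  have h3 := abs_le.1 (abs_empRisk_sub_le hlip (hF _ (hA.mem h hh z)) h h' z)
  have h4 := abs_le.1 (abs_empRisk_sub_le hlip (hF _ (hA.mem h' hh' z)) h h' z)
  constructor <;> linarith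

/-- The predictor is continuous in its argument and measurable in the sample, hence jointly
measurable. -/
lemma IsERM.measurable_loss (hA : IsERM ℓ H F A)
    (hlip : ∀ y, LipschitzWith 1 fun u => ℓ u y) (hmeas : ∀ u, Measurable (ℓ u))
    (hF : ∀ f ∈ F, LipschitzWith L f) {h : X → Rep K} (hh : h ∈ H) (hhm : Measurable h) :
    Measurable fun p : (Fin n → Obs X) × Obs X => ℓ (A h p.1 (h p.2.1)) p.2.2 := by
  have h1 : Measurable (Function.uncurry fun (v : Rep K) z => A h z v) :=
    measurable_uncurry_of_continuous_of_measurable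
      (fun z => (hF _ (hA.mem h hh z)).continuous) fun v => hA.measurable h hh v
  have h2 : Measurable fun p : (Fin n → Obs X) × Obs X => A h p.1 (h p.2.1) :=
    h1.comp ((hhm.comp (measurable_fst.comp measurable_snd)).prodMk measurable_fst)
  exact (measurable_uncurry_loss hlip hmeas).comp
    (h2.prodMk (measurable_snd.comp measurable_snd))

lemma IsERM.measurable_minEmpRisk (hA : IsERM ℓ H F A)
    (hlip : ∀ y, LipschitzWith 1 fun u => ℓ u y) (hmeas : ∀ u, Measurable (ℓ u))
    (hF : ∀ f ∈ F, LipschitzWith L f) {h : X → Rep K} (hh : h ∈ H) (hhm : Measurable h) :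
    Measurable fun z : Fin n → Obs X => minEmpRisk ℓ F h z := by
  simp only [hA.minEmpRisk_eq hh, empRisk]
  refine (Finset.measurable_sum _ fun i _ => ?_).const_mul _
  exact (hA.measurable_loss hlip hmeas hF hh hhm).comp
    (measurable_id.prodMk (measurable_pi_apply i))

end EmpRisk

/-! ### The Rademacher complexity of the specialized predictors -/

section PredComplexity

variable {n K : ℕ} {ℓ : ℝ → ℝ → ℝ} {L : ℝ≥0} {F F₀ : Set (Rep K → ℝ)}

/-- The Rademacher average of the losses of the class `F` at the represented inputs `y` and the
labels `s`, with the factor `2 / n` of the symmetrization inequality. -/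
def predComplexity (ℓ : ℝ → ℝ → ℝ) (F : Set (Rep K → ℝ)) (y : Fin n → Rep K) (s : Fin n → ℝ) : ℝ :=
  2 / n * radAvg fun (f : F) i => ℓ (f.1 (y i)) (s i)

lemma abs_predComplexity_sub_le (hrange : ∀ u y, ℓ u y ∈ Set.Icc (0 : ℝ) 1)
    (hlip : ∀ y, LipschitzWith 1 fun u => ℓ u y) (hF : ∀ f ∈ F, LipschitzWith L f)
    (hne : F.Nonempty) (y y' : Fin n → Rep K) (s : Fin n → ℝ) :
    |predComplexity ℓ F y s - predComplexity ℓ F y' s| ≤ 2 / n * ∑ i, L * ‖y i - y' i‖ := by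
  have := hne.to_subtype
  rw [predComplexity, predComplexity, ← mul_sub, abs_mul, abs_of_nonneg (by positivity)]
  refine mul_le_mul_of_nonneg_left ?_ (by positivity)
  exact abs_radAvg_sub_radAvg_le (B := 1) (fun _ _ => abs_loss_le hrange _ _)
    (fun _ _ => abs_loss_le hrange _ _) fun f =>
      Finset.sum_le_sum fun i _ => abs_loss_comp_sub_le hlip (hF f.1 f.2) _ _ _

lemma tendsto_predComplexity (hrange : ∀ u y, ℓ u y ∈ Set.Icc (0 : ℝ) 1)
    (hlip : ∀ y, LipschitzWith 1 fun u => ℓ u y) (hF : ∀ f ∈ F, LipschitzWith L f)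
    (hne : F.Nonempty) {y : ℕ → Fin n → Rep K} {y' : Fin n → Rep K}
    (hy : ∀ i, Tendsto (fun k => y k i) atTop (𝓝 (y' i))) (s : Fin n → ℝ) :
    Tendsto (fun k => predComplexity ℓ F (y k) s) atTop (𝓝 (predComplexity ℓ F y' s)) := by
  rw [tendsto_iff_norm_sub_tendsto_zero]
  refine squeeze_zero (fun _ => norm_nonneg _)
    (fun k => abs_predComplexity_sub_le hrange hlip hF hne (y k) y' s) ?_
  have : Tendsto (fun k => 2 / (n : ℝ) * ∑ i, L * ‖y k i - y' i‖) atTop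
      (𝓝 (2 / (n : ℝ) * ∑ _i : Fin n, (L : ℝ) * 0)) :=
    (tendsto_finsetSum _ fun i _ =>
      (tendsto_iff_norm_sub_tendsto_zero.1 (hy i)).const_mul _).const_mul _
  simpa using this

/-- Losses in [0, 1] differ by at most 1. Adding the two absolute bounds would only give 4, too much
for the constant 16 in part (ii). -/
lemma predComplexity_sub_le_two (hrange : ∀ u y, ℓ u y ∈ Set.Icc (0 : ℝ) 1)
    (hne : F.Nonempty) (y y' : Fin n → Rep K) (s s' : Fin n → ℝ) :
    |predComplexity ℓ F y s - predComplexity ℓ F y' s'| ≤ 2 := by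
  have := hne.to_subtype
  rw [predComplexity, predComplexity, ← mul_sub, abs_mul, abs_of_nonneg (by positivity)]
  have h1 := abs_radAvg_sub_radAvg_le (B := 1) (C := n)
    (a := fun (f : F) i => ℓ (f.1 (y i)) (s i)) (a' := fun (f : F) i => ℓ (f.1 (y' i)) (s' i))
    (fun _ _ => abs_loss_le hrange _ _)
    (fun _ _ => abs_loss_le hrange _ _) fun f => by
      refine (Finset.sum_le_sum fun i _ => (abs_le.2 ⟨?_, ?_⟩ : _ ≤ (1 : ℝ))).trans (by simp)
      · linarith [(hrange (f.1 (y i)) (s i)).1, (hrange (f.1 (y' i)) (s' i)).2]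
      · linarith [(hrange (f.1 (y' i)) (s' i)).1, (hrange (f.1 (y i)) (s i)).2]
  refine (mul_le_mul_of_nonneg_left h1 (by positivity)).trans ?_
  rw [div_mul_eq_mul_div]
  exact div_le_of_le_mul₀ (Nat.cast_nonneg n) zero_le_two le_rfl

lemma abs_predComplexity_le_two (hrange : ∀ u y, ℓ u y ∈ Set.Icc (0 : ℝ) 1)
    (hne : F.Nonempty) (y : Fin n → Rep K) (s : Fin n → ℝ) : |predComplexity ℓ F y s| ≤ 2 := by
  have := hne.to_subtype
  rw [predComplexity, abs_mul, abs_of_nonneg (by positivity : (0 : ℝ) ≤ 2 / n)]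
  refine (mul_le_mul_of_nonneg_left (abs_radAvg_le zero_le_one
    fun _ _ => abs_loss_le hrange _ _) (by positivity)).trans ?_
  rw [mul_one, div_mul_eq_mul_div]
  exact div_le_of_le_mul₀ (Nat.cast_nonneg n) zero_le_two le_rfl

lemma blockNorm_pos {y : Fin n → Rep K} (hy : y ≠ 0) : 0 < blockNorm y := by
  obtain ⟨i, hi⟩ := Function.ne_iff.1 hy
  refine Real.sqrt_pos.2 (Finset.sum_pos' (fun _ _ => sq_nonneg _) ⟨i, Finset.mem_univ i, ?_⟩)
  exact pow_pos (norm_pos_iff.2 hi) 2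

lemma exists_ne_zero (hn : 0 < n) (hK : 0 < K) : ∃ y : Fin n → Rep K, y ≠ 0 := by
  have : Nonempty (Fin n) := ⟨⟨0, hn⟩⟩
  have : Nonempty (Fin K) := ⟨⟨0, hK⟩⟩
  exact exists_ne 0

lemma QPrime_nonneg (hn : 0 < n) (hK : 0 < K) (hne : F.Nonempty) : 0 ≤ QPrime n F := by
  obtain ⟨y, hy⟩ := exists_ne_zero hn hK
  obtain ⟨f, hf⟩ := hne
  refine le_trans ?_ (le_iSup₂ (f := fun (y : Fin n → Rep K) (_ : y ≠ 0) =>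
    (((blockNorm y)⁻¹ : ℝ) : EReal) * gaussAvg {v : Fin n → ℝ | ∃ f ∈ F, v = fun i => f (y i)}) y hy)
  exact mul_nonneg (by exact_mod_cast (inv_pos.2 (blockNorm_pos hy)).le)
    (gaussAvg_nonneg ⟨_, f, hf, rfl⟩)

lemma coe_toReal_QPrime (hn : 0 < n) (hK : 0 < K) (hne : F.Nonempty) (hQ : QPrime n F ≠ ⊤) :
    ((QPrime n F).toReal : EReal) = QPrime n F :=
  EReal.coe_toReal hQ (EReal.bot_lt_zero.trans_le (QPrime_nonneg hn hK hne)).ne'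

lemma gaussAvg_le_QPrime_mul (hn : 0 < n) (hK : 0 < K) (hne : F.Nonempty) (hQ : QPrime n F ≠ ⊤)
    {y : Fin n → Rep K} (hy : y ≠ 0) :
    gaussAvg {v : Fin n → ℝ | ∃ f ∈ F, v = fun i => f (y i)}
      ≤ (((QPrime n F).toReal * blockNorm y : ℝ) : EReal) := by
  have hb := blockNorm_pos hy
  have h1 := le_iSup₂ (f := fun (y : Fin n → Rep K) (_ : y ≠ 0) => (((blockNorm y)⁻¹ : ℝ) : EReal)
    * gaussAvg {v : Fin n → ℝ | ∃ f ∈ F, v = fun i => f (y i)}) y hy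
  change _ ≤ QPrime n F at h1
  obtain ⟨f, hf⟩ := id hne
  have h0 : 0 ≤ gaussAvg {v : Fin n → ℝ | ∃ f ∈ F, v = fun i => f (y i)} :=
    gaussAvg_nonneg ⟨_, f, hf, rfl⟩
  generalize gaussAvg {v : Fin n → ℝ | ∃ f ∈ F, v = fun i => f (y i)} = G at h0 h1
  rw [← coe_toReal_QPrime hn hK hne hQ] at h1
  induction G with
  | bot => exact bot_le
  | top =>
    rw [EReal.coe_mul_top_of_pos (inv_pos.2 hb)] at h1
    exact absurd h1 (not_le.2 (EReal.coe_lt_top _))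
  | coe g =>
    rw [← EReal.coe_mul, EReal.coe_le_coe_iff, inv_mul_le_iff₀ hb] at h1
    rw [EReal.coe_le_coe_iff]
    linarith

lemma two_mul_sqrt_pi_div_two : 2 * √(Real.pi / 2) = √(2 * Real.pi) := by
  rw [show 2 * Real.pi = 2 ^ 2 * (Real.pi / 2) by ring, Real.sqrt_mul (by positivity),
    Real.sqrt_sq zero_le_two]

/-- The complexity of the predictors is controlled by `Q'` and the size of the representation. -/
lemma predComplexity_le (hn : 0 < n) (hK : 0 < K) (hrange : ∀ u y, ℓ u y ∈ Set.Icc (0 : ℝ) 1)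
    (hlip : ∀ y, LipschitzWith 1 fun u => ℓ u y) (hF : ∀ f ∈ F, LipschitzWith L f)
    (hQ : QPrime n F ≠ ⊤) (hF₀ : F₀ ⊆ F) (hne : F₀.Nonempty) (y : Fin n → Rep K)
    (s : Fin n → ℝ) :
    predComplexity ℓ F₀ y s ≤ √(2 * Real.pi) / n * (QPrime n F).toReal * blockNorm y := by
  have hn' : (0 : ℝ) < n := by exact_mod_cast hn
  have hne' := hne.mono hF₀
  have main : ∀ y : Fin n → Rep K, y ≠ 0 → predComplexity ℓ F₀ y s
      ≤ √(2 * Real.pi) / n * (QPrime n F).toReal * blockNorm y := fun y hy => by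
    have := hne.to_subtype
    have h1 := radAvg_le_gaussAvg (Equiv.prodPUnit.{0, 0} (Fin n)).symm
      (fun (f : F₀) i => ℓ (f.1 (y i)) (s i)) (fun f i => f.1 (y i))
      (Y := {v : Fin n → ℝ | ∃ f ∈ F, v = fun i => f (y i)}) (fun f => ⟨f.1, hF₀ f.2, rfl⟩)
      (C := 1) (fun _ _ => abs_loss_le hrange _ _) zero_le_one fun f f' i => by
        simpa [Real.sqrt_sq_eq_abs] using abs_loss_sub_le hlip (f.1 (y i)) (f'.1 (y i)) (s i)
    have h2 := h1.trans (mul_le_mul_of_nonneg_left (gaussAvg_le_QPrime_mul hn hK hne' hQ hy)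
      (by exact_mod_cast (by positivity : 0 ≤ √(Real.pi / 2) * 1)))
    rw [← EReal.coe_mul, EReal.coe_le_coe_iff] at h2
    refine (mul_le_mul_of_nonneg_left h2 (by positivity : 0 ≤ 2 / (n : ℝ))).trans (le_of_eq ?_)
    rw [← two_mul_sqrt_pi_div_two]
    ring
  rcases eq_or_ne y 0 with rfl | hy
  -- The supremum defining Q' omits y = 0, so this case is the limit of the bound along nonzero
  -- vectors shrinking to 0.
  · obtain ⟨e, he⟩ := exists_ne_zero hn hK
    have hlim : Tendsto (fun k : ℕ => (1 / ((k : ℝ) + 1)) • e) atTop (𝓝 0) := by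
      simpa using (tendsto_one_div_add_atTop_nhds_zero_nat (𝕜 := ℝ)).smul_const e
    have h1 := tendsto_predComplexity hrange hlip (fun f hf => hF f (hF₀ hf)) hne
      (fun i => (tendsto_pi_nhds.1 hlim) i) s
    have hcont : Continuous fun y : Fin n → Rep K => blockNorm y := by
      unfold blockNorm
      fun_prop
    refine le_of_tendsto_of_tendsto' h1 ((hcont.tendsto 0).comp hlim |>.const_mul _) fun k => ?_
    exact main _ (smul_ne_zero (by positivity) he)
  · exact main y hy

end PredComplexity

/-! ### Samples from a random task -/

section SampleLaw

/-- Boxes generate the product σ-algebra, and the mass of a box is a product of measurable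
evaluations of μ. -/
lemma measurable_pi_probabilityMeasure {Ω : Type*} [MeasurableSpace Ω] (n : ℕ) :
    Measurable fun μ : ProbabilityMeasure Ω => Measure.pi fun _ : Fin n => (μ : Measure Ω) := by
  refine Measurable.measure_of_isPiSystem_of_isProbabilityMeasure
    (generateFrom_pi (α := fun _ : Fin n => Ω)).symm isPiSystem_pi ?_
  rintro _ ⟨s, hs, rfl⟩
  simp only [Measure.pi_pi]
  refine Finset.measurable_prod _ fun i _ => ?_
  exact (Measure.measurable_coe (hs i (Set.mem_univ i))).comp measurable_subtype_coe

variable {X : Type*} [MeasurableSpace X]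

/-- The kernel sending a task to the law of an `n`-sample from it. -/
def sampleKernel (X : Type*) [MeasurableSpace X] (n : ℕ) :
    Kernel (ProbabilityMeasure (Obs X)) (Fin n → Obs X) :=
  ⟨fun μ => Measure.pi fun _ : Fin n => (μ : Measure (Obs X)), measurable_pi_probabilityMeasure n⟩

instance (n : ℕ) : IsMarkovKernel (sampleKernel X n) :=
  ⟨fun μ => by
    change IsProbabilityMeasure (Measure.pi fun _ : Fin n => (μ : Measure (Obs X)))
    infer_instance⟩

variable (η : Measure (ProbabilityMeasure (Obs X))) [IsProbabilityMeasure η] (n : ℕ)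

lemma sampleLaw_eq_snd : sampleLaw η n = (η ⊗ₘ sampleKernel X n).snd :=
  (Measure.snd_compProd η (sampleKernel X n)).symm

instance : IsProbabilityMeasure (sampleLaw η n) := by
  rw [sampleLaw_eq_snd]
  infer_instance

variable {η n}

lemma integrable_integral_pi {f : (Fin n → Obs X) → ℝ} (hf : Measurable f) {C : ℝ}
    (hC : ∀ z, |f z| ≤ C) : Integrable (fun μ : ProbabilityMeasure (Obs X) =>
      ∫ z, f z ∂(Measure.pi fun _ : Fin n => (μ : Measure (Obs X)))) η := by
  refine Integrable.of_bound ?_ C (ae_of_all _ fun μ => ?_)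
  · exact (hf.stronglyMeasurable.integral_kernel (κ := sampleKernel X n)).aestronglyMeasurable
  · have := norm_integral_le_of_norm_le_const
      (μ := Measure.pi fun _ : Fin n => (μ : Measure (Obs X))) (f := f) (C := C) (ae_of_all _ hC)
    simpa using this

lemma integral_sampleLaw {f : (Fin n → Obs X) → ℝ} (hf : Measurable f) {C : ℝ}
    (hC : ∀ z, |f z| ≤ C) :
    ∫ z, f z ∂(sampleLaw η n)
      = ∫ μ : ProbabilityMeasure (Obs X),
          ∫ z, f z ∂(Measure.pi fun _ : Fin n => (μ : Measure (Obs X))) ∂η := by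
  rw [sampleLaw_eq_snd, Measure.snd, integral_map measurable_snd.aemeasurable
    hf.aestronglyMeasurable, Measure.integral_compProd]
  · rfl
  · exact Integrable.of_bound (hf.comp measurable_snd).aestronglyMeasurable C
      (ae_of_all _ fun p => hC p.2)

-- Each single observation of a random-task sample has law `mixture η`, although the observations
-- need not be independent under `sampleLaw η n`.
omit [IsProbabilityMeasure η] in
lemma lintegral_sampleLaw_eval {f : Obs X → ℝ≥0∞} (hf : Measurable f) (i : Fin n) :
    ∫⁻ z, f (z i) ∂(sampleLaw η n) = ∫⁻ p, f p ∂(mixture η) := by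
  have hc : Measurable fun μ : ProbabilityMeasure (Obs X) => (μ : Measure (Obs X)) :=
    measurable_subtype_coe
  rw [sampleLaw, mixture, Measure.lintegral_bind (measurable_pi_probabilityMeasure n).aemeasurable
    (f := fun z : Fin n → Obs X => f (z i)) (hf.comp (measurable_pi_apply i)).aemeasurable,
    Measure.lintegral_bind (μ := fun μ : ProbabilityMeasure (Obs X) => (μ : Measure (Obs X)))
      (m := η) hc.aemeasurable hf.aemeasurable]
  refine lintegral_congr fun μ => ?_
  exact (measurePreserving_eval (fun _ : Fin n => (μ : Measure (Obs X))) i).lintegral_comp hf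

/-- The mean size of the representation of a sample is at most its root mean square. -/
lemma lintegral_blockNorm_le {K : ℕ} (hn : 0 < n) {h : X → Rep K} (hh : Measurable h) :
    ∫⁻ z, ENNReal.ofReal (blockNorm fun i => h (z i).1) ∂(sampleLaw η n)
      ≤ n * ((∫⁻ p, ‖h p.1‖ₑ ^ 2 ∂(mixture η)) / n) ^ (1 / 2 : ℝ) := by
  set I := ∫⁻ p, ‖h p.1‖ₑ ^ 2 ∂(mixture η)
  have hn0 : (n : ℝ≥0∞) ≠ 0 := by exact_mod_cast hn.ne'
  have hm : Measurable fun z : Fin n → Obs X => ENNReal.ofReal (blockNorm fun i => h (z i).1) := by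
    unfold blockNorm
    fun_prop
  have hsq : ∀ z : Fin n → Obs X, ENNReal.ofReal (blockNorm fun i => h (z i).1) ^ (2 : ℝ)
      = ∑ i, ‖h (z i).1‖ₑ ^ 2 := fun z => by
    have h0 : 0 ≤ ∑ i, ‖h (z i).1‖ ^ 2 := Finset.sum_nonneg fun i _ => sq_nonneg _
    rw [show (2 : ℝ) = (2 : ℕ) by norm_num, ENNReal.rpow_natCast,
      blockNorm, ← ENNReal.ofReal_pow (Real.sqrt_nonneg _), Real.sq_sqrt h0,
      ENNReal.ofReal_sum_of_nonneg fun i _ => sq_nonneg _]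
    refine Finset.sum_congr rfl fun i _ => ?_
    rw [ENNReal.ofReal_pow (norm_nonneg _), ofReal_norm]
  have hI : ∫⁻ z : Fin n → Obs X, ∑ i, ‖h (z i).1‖ₑ ^ 2 ∂(sampleLaw η n) = n * I := by
    have hf : Measurable fun p : Obs X => ‖h p.1‖ₑ ^ 2 := by fun_prop
    rw [lintegral_finsetSum (f := fun i (z : Fin n → Obs X) => ‖h (z i).1‖ₑ ^ 2) _
      fun i _ => hf.comp (measurable_pi_apply i)]
    simp_rw [fun i : Fin n => lintegral_sampleLaw_eval (η := η) hf i]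
    simp [I]
  -- Cauchy–Schwarz against the constant 1, in [0, ∞] so that an infinite second moment is allowed.
  have hCS := ENNReal.lintegral_mul_le_Lp_mul_Lq (sampleLaw η n) Real.HolderConjugate.two_two
    hm.aemeasurable (aemeasurable_const (b := (1 : ℝ≥0∞)))
  simp only [Pi.mul_apply, mul_one, hsq, hI, ENNReal.one_rpow, lintegral_const, measure_univ] at hCS
  refine hCS.trans (le_of_eq ?_)
  have e : (n : ℝ≥0∞) * I = (n : ℝ≥0∞) ^ (2 : ℝ) * (I / n) := by
    rw [ENNReal.rpow_two, sq, mul_assoc, ENNReal.mul_div_cancel hn0 (ENNReal.natCast_ne_top n)]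
  rw [e, ENNReal.mul_rpow_of_nonneg _ _ (by norm_num), ← ENNReal.rpow_mul]
  norm_num

end SampleLaw

/-! ### The environment risk -/

section EnvRisk

variable {X : Type*} [MeasurableSpace X] {n K : ℕ} {ℓ : ℝ → ℝ → ℝ} {L : ℝ≥0}
  {F F₀ : Set (Rep K → ℝ)} {H : Set (X → Rep K)}
  {A : (X → Rep K) → (Fin n → Obs X) → (Rep K → ℝ)}

/-- The complexity of the predictors on the sample `z` represented by `h`. -/
def sampleComplexity (ℓ : ℝ → ℝ → ℝ) (F : Set (Rep K → ℝ)) (h : X → Rep K)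
    (z : Fin n → Obs X) : ℝ :=
  predComplexity ℓ F (fun i => h (z i).1) fun i => (z i).2

lemma measurable_loss_comp (hlip : ∀ y, LipschitzWith 1 fun u => ℓ u y)
    (hmeas : ∀ u, Measurable (ℓ u)) {f : Rep K → ℝ} (hf : LipschitzWith L f) {h : X → Rep K}
    (hh : Measurable h) : Measurable fun p : Obs X => ℓ (f (h p.1)) p.2 :=
  (measurable_uncurry_loss hlip hmeas).comp
    ((hf.continuous.measurable.comp (hh.comp measurable_fst)).prodMk measurable_snd)

lemma measurable_sampleComplexity (hlip : ∀ y, LipschitzWith 1 fun u => ℓ u y)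
    (hmeas : ∀ u, Measurable (ℓ u)) (hF : ∀ f ∈ F, LipschitzWith L f) (hc : F.Countable)
    {h : X → Rep K} (hh : Measurable h) :
    Measurable fun z : Fin n → Obs X => sampleComplexity ℓ F h z := by
  have := hc.to_subtype
  exact (measurable_radAvg_comp (g := fun (f : F) (p : Obs X) => ℓ (f.1 (h p.1)) p.2) fun f =>
    measurable_loss_comp hlip hmeas (hF f.1 f.2) hh).const_mul _

/-- The environment risk exceeds the expected minimal empirical risk by at most the expected
complexity of the predictors. -/
lemma envRisk_le (hn : 0 < n) (hrange : ∀ u y, ℓ u y ∈ Set.Icc (0 : ℝ) 1)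
    (hlip : ∀ y, LipschitzWith 1 fun u => ℓ u y) (hmeas : ∀ u, Measurable (ℓ u))
    (hF : ∀ f ∈ F, LipschitzWith L f) (hF₀ : F₀ ⊆ F) (hc : F₀.Countable) (hne : F₀.Nonempty)
    (hdense : ∀ f ∈ F, ∃ u : ℕ → Rep K → ℝ,
      (∀ k, u k ∈ F₀) ∧ ∀ v, Tendsto (fun k => u k v) atTop (𝓝 (f v)))
    (hA : IsERM ℓ H F A) (η : Measure (ProbabilityMeasure (Obs X))) [IsProbabilityMeasure η]
    {h : X → Rep K} (hh : h ∈ H) (hhm : Measurable h) :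
    envRisk ℓ η A h ≤ ∫ z, minEmpRisk ℓ F h z ∂(sampleLaw η n)
      + ∫ z : Fin n → Obs X, sampleComplexity ℓ F₀ h z ∂(sampleLaw η n) := by
  have := hc.to_subtype
  have := hne.to_subtype
  have hF₀' := fun f hf => hF f (hF₀ hf)
  have hm := hA.measurable_minEmpRisk hlip hmeas hF hh hhm
  have hm1 : ∀ z, |minEmpRisk ℓ F h z| ≤ 1 := fun z => by
    rw [hA.minEmpRisk_eq hh]
    have := empRisk_mem_Icc hrange (A h z) h z
    exact abs_le.2 ⟨by linarith [this.1], this.2⟩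
  have hr := measurable_sampleComplexity (n := n) hlip hmeas hF₀' hc hhm
  have hr2 : ∀ z : Fin n → Obs X, |sampleComplexity ℓ F₀ h z| ≤ 2 := fun z =>
    abs_predComplexity_le_two hrange hne _ _
  rw [integral_sampleLaw hm hm1, integral_sampleLaw hr hr2, ← integral_add
    (integrable_integral_pi hm hm1) (integrable_integral_pi hr hr2)]
  -- Nonnegativity of the loss removes the need for integrability of the inner risk as a function of
  -- the task.
  refine integral_mono_of_nonneg (ae_of_all _ fun μ => integral_nonneg fun z =>
    integral_nonneg fun p => (hrange _ _).1)
    ((integrable_integral_pi hm hm1).add (integrable_integral_pi hr hr2))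
    (ae_of_all _ fun μ => ?_)
  set g : F₀ → Obs X → ℝ := fun f p => ℓ (f.1 (h p.1)) p.2
  have hg : ∀ f, Measurable (g f) := fun f =>
    measurable_loss_comp hlip hmeas (hF₀' f.1 f.2) hhm
  have hg1 : ∀ f p, |g f p| ≤ 1 := fun f p => abs_loss_le hrange _ _
  set Q := Measure.pi fun _ : Fin n => (μ : Measure (Obs X))
  have hDi : Integrable (fun z : Fin n → Obs X => maxDev (μ : Measure (Obs X)) g z) Q :=
    Integrable.of_bound (measurable_maxDev hg).aestronglyMeasurable 2
      (ae_of_all _ fun z => abs_maxDev_le hg1 z)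
  have hmi : Integrable (fun z => minEmpRisk ℓ F h z) Q :=
    Integrable.of_bound hm.aestronglyMeasurable 1 (ae_of_all _ hm1)
  calc _ ≤ ∫ z, (minEmpRisk ℓ F h z + maxDev (μ : Measure (Obs X)) g z) ∂Q := by
        refine integral_mono_of_nonneg (ae_of_all _ fun z => integral_nonneg fun p =>
          (hrange _ _).1) (hmi.add hDi) (ae_of_all _ fun z => ?_)
        -- The minimizer depends on z, but the deviation bound is uniform over F₀ and survives
        -- pointwise limits, so it applies sample by sample.
        obtain ⟨u, hu, hlim⟩ := hdense _ (hA.mem h hh z)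
        have key := dev_le_maxDev_of_tendsto (P := (μ : Measure (Obs X))) hg hg1
          (u := fun k => ⟨u k, hu k⟩) (g' := fun p => ℓ (A h z (h p.1)) p.2)
          (fun p => ((hlip p.2).continuous.tendsto _).comp (hlim (h p.1))) z
        have e : minEmpRisk ℓ F h z = (n : ℝ)⁻¹ * ∑ i, ℓ (A h z (h (z i).1)) (z i).2 := by
          rw [hA.minEmpRisk_eq hh, empRisk, one_div]
        simp only at key ⊢
        linarith
    _ = ∫ z, minEmpRisk ℓ F h z ∂Q + ∫ z, maxDev (μ : Measure (Obs X)) g z ∂Q :=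
        integral_add hmi hDi
    _ ≤ ∫ z, minEmpRisk ℓ F h z ∂Q + ∫ z, sampleComplexity ℓ F₀ h z ∂Q := by
        have := integral_maxDev_le (P := (μ : Measure (Obs X))) hn hg hg1
        rw [← integral_const_mul] at this
        exact add_le_add le_rfl this

/-- The expected complexity of the predictors is controlled by `Q'` and the second moment of the
representation. -/
lemma integral_sampleComplexity_le (hn : 0 < n) (hK : 0 < K)
    (hrange : ∀ u y, ℓ u y ∈ Set.Icc (0 : ℝ) 1)
    (hlip : ∀ y, LipschitzWith 1 fun u => ℓ u y) (hmeas : ∀ u, Measurable (ℓ u))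
    (hF : ∀ f ∈ F, LipschitzWith L f) (hQ : QPrime n F ≠ ⊤)
    (hF₀ : F₀ ⊆ F) (hc : F₀.Countable) (hne : F₀.Nonempty)
    (η : Measure (ProbabilityMeasure (Obs X))) [IsProbabilityMeasure η]
    {h : X → Rep K} (hhm : Measurable h) :
    ((∫ z : Fin n → Obs X, sampleComplexity ℓ F₀ h z ∂(sampleLaw η n) : ℝ) : EReal)
      ≤ ((√(2 * Real.pi) : ℝ) : EReal) * QPrime n F
        * ((((∫⁻ p, ‖h p.1‖ₑ ^ 2 ∂(mixture η)) / (n : ℝ≥0∞)) ^ (1 / 2 : ℝ) : ℝ≥0∞) : EReal) := by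
  have hn' : (0 : ℝ) < n := by exact_mod_cast hn
  set q := (QPrime n F).toReal
  have hq : (q : EReal) = QPrime n F := coe_toReal_QPrime hn hK (hne.mono hF₀) hQ
  have hq0 : 0 ≤ q := EReal.coe_nonneg.1 (hq ▸ QPrime_nonneg hn hK (hne.mono hF₀))
  have hri : Integrable (fun z : Fin n → Obs X => sampleComplexity ℓ F₀ h z) (sampleLaw η n) :=
    Integrable.of_bound (measurable_sampleComplexity hlip hmeas
      (fun f hf => hF f (hF₀ hf)) hc hhm).aestronglyMeasurable 2
      (ae_of_all _ fun z => abs_predComplexity_le_two hrange hne _ _)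
  set S := ((∫⁻ p, ‖h p.1‖ₑ ^ 2 ∂(mixture η)) / (n : ℝ≥0∞)) ^ (1 / 2 : ℝ)
  -- The estimate is made in [0, ∞], where truncating the left side at zero only increases it.
  have key : ENNReal.ofReal (∫ z : Fin n → Obs X, sampleComplexity ℓ F₀ h z ∂(sampleLaw η n))
      ≤ ENNReal.ofReal (√(2 * Real.pi) * q) * S := by
    calc _ ≤ ∫⁻ z : Fin n → Obs X, ENNReal.ofReal (sampleComplexity ℓ F₀ h z)
          ∂(sampleLaw η n) := by
          refine (ENNReal.ofReal_le_ofReal ?_).trans ENNReal.ofReal_toReal_le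
          rw [integral_eq_lintegral_pos_part_sub_lintegral_neg_part hri]
          exact sub_le_self _ ENNReal.toReal_nonneg
      _ ≤ ∫⁻ z : Fin n → Obs X, ENNReal.ofReal (√(2 * Real.pi) / n * q)
          * ENNReal.ofReal (blockNorm fun i => h (z i).1) ∂(sampleLaw η n) := by
          refine lintegral_mono fun z => ?_
          rw [← ENNReal.ofReal_mul (by positivity)]
          exact ENNReal.ofReal_le_ofReal
            (predComplexity_le hn hK hrange hlip hF hQ hF₀ hne _ _)
      _ ≤ ENNReal.ofReal (√(2 * Real.pi) / n * q) * (n * S) := by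
          rw [lintegral_const_mul' _ _ ENNReal.ofReal_ne_top]
          exact mul_le_mul_right (lintegral_blockNorm_le hn hhm) _
      _ = _ := by
          rw [← mul_assoc, ← ENNReal.ofReal_natCast, ← ENNReal.ofReal_mul (by positivity)]
          congr 2
          field_simp
  have h2 := EReal.coe_ennreal_le_coe_ennreal_iff.2 key
  rw [EReal.coe_ennreal_mul, EReal.coe_ennreal_ofReal, EReal.coe_ennreal_ofReal,
    max_eq_left (by positivity : 0 ≤ √(2 * Real.pi) * q)] at h2
  rw [← hq, ← EReal.coe_mul]
  exact (EReal.coe_le_coe_iff.2 (le_max_left _ _)).trans h2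

end EnvRisk

/-! ### Complexity bounds over the class of representations -/

section Main

variable {X : Type*} [MeasurableSpace X] {n K T : ℕ} {ℓ : ℝ → ℝ → ℝ} {L : ℝ≥0}
  {F F₀ : Set (Rep K → ℝ)} {H H₀ : Set (X → Rep K)}
  {A : (X → Rep K) → (Fin n → Obs X) → (Rep K → ℝ)}

/-- Moves the task index to the front. -/
def taskEquiv (K T n : ℕ) : Fin K × Fin T × Fin n ≃ Fin T × (Fin K × Fin n) where
  toFun p := (p.2.1, p.1, p.2.2)
  invFun p := (p.2.1, p.1, p.2.2)

lemma minEmpRisk_mem_Icc (hrange : ∀ u y, ℓ u y ∈ Set.Icc (0 : ℝ) 1) (hA : IsERM ℓ H F A)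
    {h : X → Rep K} (hh : h ∈ H) (z : Fin n → Obs X) :
    minEmpRisk ℓ F h z ∈ Set.Icc (0 : ℝ) 1 := by
  rw [hA.minEmpRisk_eq hh]
  exact empRisk_mem_Icc hrange _ _ _

/-- The Rademacher complexity of the minimal empirical risks is controlled by the Gaussian average
of the representations. -/
lemma radAvg_minEmpRisk_le (hrange : ∀ u y, ℓ u y ∈ Set.Icc (0 : ℝ) 1)
    (hlip : ∀ y, LipschitzWith 1 fun u => ℓ u y) (hF : ∀ f ∈ F, LipschitzWith L f)
    (hA : IsERM ℓ H F A) (hH₀ : H₀ ⊆ H) (hne : H₀.Nonempty) (Z : Fin T → Fin n → Obs X) :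
    ((2 / T * radAvg fun (h : H₀) t => minEmpRisk ℓ F h.1 (Z t) : ℝ) : EReal)
      ≤ ((√(2 * Real.pi) * L / (T * √n) : ℝ) : EReal)
        * gaussAvg (repImage H fun t i => (Z t i).1) := by
  have := hne.to_subtype
  -- Each task contributes one sign and one block of Kn Gaussian variables; the block distance is
  -- the Euclidean norm in the stability bound.
  have h1 := radAvg_le_gaussAvg (taskEquiv K T n)
    (fun (h : H₀) t => minEmpRisk ℓ F h.1 (Z t)) (fun h p => h.1 (Z p.2.1 p.2.2).1 p.1)
    (Y := repImage H fun t i => (Z t i).1) (fun h => ⟨h.1, hH₀ h.2, rfl⟩) (C := 1)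
    (fun h t => by
      have := minEmpRisk_mem_Icc hrange hA (hH₀ h.2) (Z t)
      exact abs_le.2 ⟨by linarith [this.1], this.2⟩)
    (b := L / √n) (by positivity) fun h h' t => by
      refine (hA.abs_minEmpRisk_sub_le hlip hF (hH₀ h.2) (hH₀ h'.2) (Z t)).trans (le_of_eq ?_)
      congr 2
      rw [Fintype.sum_prod_type, Finset.sum_comm]
      refine Finset.sum_congr rfl fun i _ => ?_
      simp [EuclideanSpace.norm_sq_eq, taskEquiv]
  have h2 := mul_le_mul_of_nonneg_left h1
    (by exact_mod_cast (by positivity : 0 ≤ 2 / (T : ℝ)) : (0 : EReal) ≤ ((2 / T : ℝ) : EReal))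
  rw [← mul_assoc, ← EReal.coe_mul, ← EReal.coe_mul] at h2
  refine h2.trans (le_of_eq ?_)
  congr 2
  rw [← two_mul_sqrt_pi_div_two]
  ring

lemma measure_le_ofReal {Ω : Type*} [MeasurableSpace Ω] {P : Measure Ω} [IsFiniteMeasure P]
    {s t : Set Ω} (hst : s ⊆ t) {δ : ℝ} (ht : P.real t ≤ δ) : P s ≤ ENNReal.ofReal δ := by
  refine (measure_mono hst).trans ?_
  rw [← ofReal_measureReal]
  exact ENNReal.ofReal_le_ofReal ht

/-- The supremum of the sample complexities over a family of representations. -/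
def supComplexity (ℓ : ℝ → ℝ → ℝ) (F : Set (Rep K → ℝ)) (H : Set (X → Rep K))
    (z : Fin n → Obs X) : ℝ :=
  ⨆ h : H, sampleComplexity ℓ F h.1 z

omit [MeasurableSpace X] in
lemma bddAbove_sampleComplexity (hrange : ∀ u y, ℓ u y ∈ Set.Icc (0 : ℝ) 1)
    (hne : F.Nonempty) (z : Fin n → Obs X) :
    BddAbove (Set.range fun h : H => sampleComplexity ℓ F h.1 z) :=
  ⟨2, by
    rintro _ ⟨h, rfl⟩
    exact (abs_le.1 (abs_predComplexity_le_two hrange hne _ _)).2⟩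

omit [MeasurableSpace X] in
lemma abs_supComplexity_sub_le (hrange : ∀ u y, ℓ u y ∈ Set.Icc (0 : ℝ) 1)
    (hne : F.Nonempty) (hH : H.Nonempty) (z z' : Fin n → Obs X) :
    |supComplexity ℓ F H z - supComplexity ℓ F H z'| ≤ 2 :=
  have := hH.to_subtype
  abs_ciSup_sub_ciSup_le (bddAbove_sampleComplexity hrange hne z)
    (bddAbove_sampleComplexity hrange hne z')
    fun _ => predComplexity_sub_le_two hrange hne _ _ _ _

omit [MeasurableSpace X] in
lemma abs_supComplexity_le (hrange : ∀ u y, ℓ u y ∈ Set.Icc (0 : ℝ) 1)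
    (hne : F.Nonempty) (hH : H.Nonempty) (z : Fin n → Obs X) :
    |supComplexity ℓ F H z| ≤ 2 := by
  have := hH.to_subtype
  have h := abs_ciSup_sub_ciSup_le (g := fun _ : H => (0 : ℝ))
    (bddAbove_sampleComplexity hrange hne z) ⟨0, by rintro _ ⟨i, rfl⟩; simp⟩ (C := 2)
    fun i => by rw [sub_zero]; exact abs_predComplexity_le_two hrange hne _ _
  simpa [supComplexity] using h

omit [MeasurableSpace X] in
/-- The supremal complexity of a sample is controlled by `Q'` and the size of its
representations. -/
lemma supComplexity_le (hn : 0 < n) (hK : 0 < K) (hrange : ∀ u y, ℓ u y ∈ Set.Icc (0 : ℝ) 1)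
    (hlip : ∀ y, LipschitzWith 1 fun u => ℓ u y) (hF : ∀ f ∈ F, LipschitzWith L f)
    (hQ : QPrime n F ≠ ⊤) (hF₀ : F₀ ⊆ F) (hne : F₀.Nonempty) (hH₀ : H₀ ⊆ H) (hHne : H₀.Nonempty)
    (z : Fin n → Obs X) :
    ((supComplexity ℓ F₀ H₀ z : ℝ) : EReal)
      ≤ ((√(2 * Real.pi) / n * (QPrime n F).toReal : ℝ) : EReal)
        * ⨆ g ∈ H, ((blockNorm fun i => g (z i).1 : ℝ) : EReal) := by
  have := hHne.to_subtype
  have hq0 : 0 ≤ (QPrime n F).toReal := EReal.toReal_nonneg (QPrime_nonneg hn hK (hne.mono hF₀))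
  refine EReal.ge_of_forall_gt_iff_ge.1 fun (x : ℝ) hx => ?_
  obtain ⟨h, hh⟩ := exists_lt_of_lt_ciSup (EReal.coe_lt_coe_iff.1 hx)
  refine (EReal.coe_le_coe_iff.2
    (hh.le.trans (predComplexity_le hn hK hrange hlip hF hQ hF₀ hne _ _))).trans ?_
  rw [EReal.coe_mul]
  exact mul_le_mul_of_nonneg_left
    (le_biSup (fun g : X → Rep K => ((blockNorm fun i => g (z i).1 : ℝ) : EReal)) (hH₀ h.2))
    (by exact_mod_cast (by positivity : 0 ≤ √(2 * Real.pi) / n * (QPrime n F).toReal))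

lemma coe_sum_eq_sum_coe {ι : Type*} (s : Finset ι) (f : ι → ℝ) :
    ((∑ i ∈ s, f i : ℝ) : EReal) = ∑ i ∈ s, (f i : EReal) :=
  map_sum (⟨⟨Real.toEReal, EReal.coe_zero⟩, EReal.coe_add⟩ : ℝ →+ EReal) f s

lemma coe_mul_sum_of_nonneg {ι : Type*} (s : Finset ι) {c : ℝ} (hc : 0 ≤ c) {f : ι → EReal} :
    (c : EReal) * ∑ i ∈ s, f i = ∑ i ∈ s, (c : EReal) * f i := by
  classical
  induction s using Finset.induction_on with
  | empty => simp
  | insert a s ha ih =>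
    rw [Finset.sum_insert ha, Finset.sum_insert ha, EReal.left_distrib_of_nonneg_of_ne_top
      (EReal.coe_nonneg.2 hc) (EReal.coe_ne_top c), ih]

end Main

end MTRL

end

/-! ### The two generalization bounds -/

open MTRL

theorem theorem14 {X : Type*} [MeasurableSpace X] (K n T : ℕ)
    (hK : 0 < K) (hn : 0 < n) (hT : 0 < T)
    -- the loss
    (ℓ : ℝ → ℝ → ℝ) (hℓ_range : ∀ u y, ℓ u y ∈ Set.Icc (0 : ℝ) 1)
    (hℓ_lip : ∀ y, LipschitzWith 1 fun u => ℓ u y) (hℓ_meas : ∀ u, Measurable (ℓ u))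
    -- the specialized predictors and the representations
    (L : ℝ≥0) (hL : 0 < L)
    (F : Set (MTRL.Rep K → ℝ)) (hF : ∀ f ∈ F, LipschitzWith L f)
    (hQ : MTRL.QPrime n F ≠ ⊤)
    (H : Set (X → MTRL.Rep K)) (hH_meas : ∀ h ∈ H, Measurable h)
    (hH_sep : MTRL.PointwiseSeparable H)
    -- the algorithm
    (A : (X → MTRL.Rep K) → (Fin n → MTRL.Obs X) → (MTRL.Rep K → ℝ))
    (hA : MTRL.IsERM ℓ H F A)
    -- the environment
    (η : Measure (ProbabilityMeasure (MTRL.Obs X))) [IsProbabilityMeasure η]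
    (δ : ℝ) (hδ : δ ∈ Set.Ioo (0 : ℝ) 1) :
    -- (i) the bad event has outer measure at most `δ`
    (Measure.pi fun _ : Fin T => MTRL.sampleLaw η n)
      {Z : Fin T → Fin n → MTRL.Obs X | ¬ ∀ h ∈ H,
        ((MTRL.envRisk ℓ η A h - (1 / (T : ℝ)) * ∑ t, MTRL.minEmpRisk ℓ F h (Z t) : ℝ) : EReal) ≤
          ((√(2 * Real.pi) * L / (T * √n) : ℝ) : EReal)
              * MTRL.gaussAvg (MTRL.repImage H fun t i => (Z t i).1)
            + ((√(2 * Real.pi) : ℝ) : EReal) * MTRL.QPrime n F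
              * ((⨆ g ∈ H, ((∫⁻ p, ‖g p.1‖ₑ ^ 2 ∂(MTRL.mixture η)) / (n : ℝ≥0∞)) ^ (1 / 2 : ℝ) :
                  ℝ≥0∞) : EReal)
            + ((√(9 * Real.log (2 / δ) / (2 * T)) : ℝ) : EReal)} ≤ ENNReal.ofReal δ
    ∧
    -- (ii)
    (Measure.pi fun _ : Fin T => MTRL.sampleLaw η n)
      {Z : Fin T → Fin n → MTRL.Obs X | ¬ ∀ h ∈ H,
        ((MTRL.envRisk ℓ η A h - (1 / (T : ℝ)) * ∑ t, MTRL.minEmpRisk ℓ F h (Z t) : ℝ) : EReal) ≤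
          ((√(2 * Real.pi) * L / (T * √n) : ℝ) : EReal)
              * MTRL.gaussAvg (MTRL.repImage H fun t i => (Z t i).1)
            + ((√(2 * Real.pi) / (n * T) : ℝ) : EReal) * MTRL.QPrime n F
              * (∑ t, ⨆ g ∈ H, ((MTRL.blockNorm fun i => g (Z t i).1 : ℝ) : EReal))
            + ((√(16 * Real.log (4 / δ) / T) : ℝ) : EReal)} ≤ ENNReal.ofReal δ := by
  have hT' : (0 : ℝ) < T := by exact_mod_cast hT
  have hn' : (0 : ℝ) < n := by exact_mod_cast hn
  rcases H.eq_empty_or_nonempty with rfl | ⟨h₀, hh₀⟩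
  · simp
  obtain ⟨H₀, hH₀, hH₀c, hH₀d⟩ := hH_sep
  have hH₀ne : H₀.Nonempty := by
    obtain ⟨u, hu, -⟩ := hH₀d h₀ hh₀
    exact ⟨u 0, hu 0⟩
  obtain ⟨F₀, hF₀, hF₀c, hF₀d⟩ := exists_countable_pointwise_dense fun f hf => (hF f hf).continuous
  obtain ⟨z₀⟩ := nonempty_of_isProbabilityMeasure (sampleLaw η n)
  have hF₀ne : F₀.Nonempty := by
    obtain ⟨u, hu, -⟩ := hF₀d _ (hA.mem h₀ hh₀ z₀)
    exact ⟨u 0, hu 0⟩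
  have := hH₀c.to_subtype
  have := hH₀ne.to_subtype
  set ρ := sampleLaw η n
  set g : H₀ → (Fin n → Obs X) → ℝ := fun h z => minEmpRisk ℓ F h.1 z
  have hg : ∀ h, Measurable (g h) := fun h =>
    hA.measurable_minEmpRisk hℓ_lip hℓ_meas hF (hH₀ h.2) (hH_meas _ (hH₀ h.2))
  have hgb : ∀ h z, g h z ∈ Set.Icc (0 : ℝ) 1 := fun h z =>
    minEmpRisk_mem_Icc hℓ_range hA (hH₀ h.2) z
  have hgb' : ∀ h z, |g h z| ≤ 1 := fun h z =>
    abs_le.2 ⟨by linarith [(hgb h z).1], (hgb h z).2⟩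
  -- the deterministic part of the estimate
  have hdev : ∀ h ∈ H, ∀ Z : Fin T → Fin n → Obs X,
      envRisk ℓ η A h - (1 / (T : ℝ)) * ∑ t, minEmpRisk ℓ F h (Z t)
        ≤ maxDev ρ g Z + ∫ z : Fin n → Obs X, sampleComplexity ℓ F₀ h z ∂ρ := fun h hh Z => by
    have h1 := envRisk_le hn hℓ_range hℓ_lip hℓ_meas hF hF₀ hF₀c hF₀ne hF₀d hA η hh (hH_meas h hh)
    obtain ⟨u, hu, hlim⟩ := hH₀d h hh
    -- Lipschitz stability makes m(u k) converge to m(h) at every sample, so the supremum over H₀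
    -- controls all of H.
    have h2 := dev_le_maxDev_of_tendsto (P := ρ) hg hgb' (u := fun k => ⟨u k, hu k⟩)
      (g' := fun z => minEmpRisk ℓ F h z) (fun z => by
        rw [tendsto_iff_norm_sub_tendsto_zero]
        refine squeeze_zero (fun _ => norm_nonneg _) (fun k =>
          hA.abs_minEmpRisk_sub_le hℓ_lip hF (hH₀ (hu k)) hh z) ?_
        have h3 : Tendsto (fun k => ∑ i, ‖u k (z i).1 - h (z i).1‖ ^ 2) atTop
            (𝓝 (∑ _i : Fin n, (0 : ℝ) ^ 2)) := tendsto_finsetSum _ fun i _ =>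
          (tendsto_iff_norm_sub_tendsto_zero.1 (hlim (z i).1)).pow 2
        simpa using (h3.sqrt).const_mul ((L : ℝ) / √n)) Z
    rw [one_div]
    linarith
  have hgauss := radAvg_minEmpRisk_le (T := T) hℓ_range hℓ_lip hF hA hH₀ hH₀ne
  constructor
  · set ε := √(9 * Real.log (2 / δ) / (2 * T))
    have hlog : 0 ≤ Real.log (2 / δ) := Real.log_nonneg (by
      rw [le_div_iff₀ hδ.1]; linarith [hδ.2])
    -- With V = 0 the differences are 3/T, whence the 9 in ε; the failure probability is δ/2.
    have hprob := measure_maxDev_sub_radAvg_ge_le (P := ρ) hT hg hgb (V := fun _ => 0)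
      measurable_const (B := 0) (by simp) (v := 0) (by simp) (Real.sqrt_nonneg _ : 0 ≤ ε)
    refine measure_le_ofReal (fun Z hZ => ?_) (hprob.trans ?_)
    · simp only [Set.mem_ofPred_eq] at hZ ⊢
      by_contra hlt
      refine hZ fun h hh => ?_
      have h1 := hdev h hh Z
      have h2 : envRisk ℓ η A h - (1 / (T : ℝ)) * ∑ t, minEmpRisk ℓ F h (Z t)
          ≤ 2 / T * radAvg (fun (h : H₀) t => minEmpRisk ℓ F h.1 (Z t))
            + ∫ z : Fin n → Obs X, sampleComplexity ℓ F₀ h z ∂ρ + ε := by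
        simp only [Finset.sum_const_zero, mul_zero, sub_zero, integral_zero, add_zero,
          not_le] at hlt
        linarith
      refine (EReal.coe_le_coe_iff.2 h2).trans ?_
      rw [EReal.coe_add, EReal.coe_add]
      refine add_le_add (add_le_add (hgauss Z) ?_) le_rfl
      refine (integral_sampleComplexity_le hn hK hℓ_range hℓ_lip hℓ_meas hF hQ hF₀ hF₀c hF₀ne η
        (hH_meas h hh)).trans (mul_le_mul_of_nonneg_left ?_ (mul_nonneg
          (EReal.coe_nonneg.2 (Real.sqrt_nonneg _)) (QPrime_nonneg hn hK (hF₀ne.mono hF₀))))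
      exact EReal.coe_ennreal_le_coe_ennreal_iff.2 (le_biSup (fun g : X → Rep K =>
        ((∫⁻ p, ‖g p.1‖ₑ ^ 2 ∂(mixture η)) / (n : ℝ≥0∞)) ^ (1 / 2 : ℝ)) hh)
    · rw [Real.sq_sqrt (by positivity)]
      have e : -(2 * T * (9 * Real.log (2 / δ) / (2 * T)) / (3 + 0) ^ 2) = -Real.log (2 / δ) := by
        field_simp
        ring
      rw [e, Real.exp_neg, Real.exp_log (div_pos two_pos hδ.1), inv_div]
      linarith [hδ.1]
  · set ε := √(16 * Real.log (4 / δ) / T)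
    have hlog : 0 ≤ Real.log (4 / δ) := Real.log_nonneg (by
      rw [le_div_iff₀ hδ.1]; linarith [hδ.2])
    have hFL := fun f hf => hF f (hF₀ hf)
    have hWm : Measurable fun z : Fin n → Obs X => supComplexity ℓ F₀ H₀ z :=
      Measurable.iSup fun h =>
        measurable_sampleComplexity hℓ_lip hℓ_meas hFL hF₀c (hH_meas _ (hH₀ h.2))
    have hW2 := abs_supComplexity_le (X := X) (n := n) hℓ_range hF₀ne hH₀ne
    -- Taking V to be the supremal complexity, of oscillation 2, trades its mean for its empirical
    -- average within the same event.
    have hprob := measure_maxDev_sub_radAvg_ge_le (P := ρ) hT hg hgb hWm hW2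
      (abs_supComplexity_sub_le hℓ_range hF₀ne hH₀ne) (Real.sqrt_nonneg _ : 0 ≤ ε)
    refine measure_le_ofReal (fun Z hZ => ?_) (hprob.trans ?_)
    · simp only [Set.mem_ofPred_eq] at hZ ⊢
      by_contra hlt
      refine hZ fun h hh => ?_
      have h1 := hdev h hh Z
      have hint : ∫ z : Fin n → Obs X, sampleComplexity ℓ F₀ h z ∂ρ
          ≤ ∫ z, supComplexity ℓ F₀ H₀ z ∂ρ := by
        refine integral_mono (Integrable.of_bound (measurable_sampleComplexity hℓ_lip hℓ_meas hFL
            hF₀c (hH_meas h hh)).aestronglyMeasurable 2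
            (ae_of_all _ fun z => abs_predComplexity_le_two hℓ_range hF₀ne _ _))
          (Integrable.of_bound hWm.aestronglyMeasurable 2 (ae_of_all _ hW2)) fun z => ?_
        -- The complexity is continuous in the represented inputs, so the supremum over H₀ also
        -- dominates it at h.
        obtain ⟨u, hu, hlim⟩ := hH₀d h hh
        exact le_of_tendsto' (tendsto_predComplexity hℓ_range hℓ_lip hFL hF₀ne
          (y := fun k i => u k (z i).1) (fun i => hlim (z i).1) _) fun k =>
            le_ciSup (bddAbove_sampleComplexity hℓ_range hF₀ne z) (⟨u k, hu k⟩ : H₀)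
      have h2 : envRisk ℓ η A h - (1 / (T : ℝ)) * ∑ t, minEmpRisk ℓ F h (Z t)
          ≤ 2 / T * radAvg (fun (h : H₀) t => minEmpRisk ℓ F h.1 (Z t))
            + (T : ℝ)⁻¹ * ∑ t, supComplexity ℓ F₀ H₀ (Z t) + ε := by
        rw [not_le] at hlt
        linarith
      refine (EReal.coe_le_coe_iff.2 h2).trans ?_
      rw [EReal.coe_add, EReal.coe_add]
      refine add_le_add (add_le_add (hgauss Z) ?_) le_rfl
      have hF₀ne' := hF₀ne.mono hF₀
      have hq0 : 0 ≤ (QPrime n F).toReal := EReal.toReal_nonneg (QPrime_nonneg hn hK hF₀ne')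
      rw [Finset.mul_sum, ← coe_toReal_QPrime hn hK hF₀ne' hQ, ← EReal.coe_mul,
        coe_mul_sum_of_nonneg _ (by positivity), coe_sum_eq_sum_coe]
      refine Finset.sum_le_sum fun t _ => ?_
      have h3 := mul_le_mul_of_nonneg_left (supComplexity_le hn hK hℓ_range hℓ_lip hF hQ hF₀ hF₀ne
        hH₀ hH₀ne (Z t)) (EReal.coe_nonneg.2 (by positivity : 0 ≤ (T : ℝ)⁻¹))
      rw [← mul_assoc, ← EReal.coe_mul, ← EReal.coe_mul] at h3
      refine h3.trans (le_of_eq ?_)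
      congr 2
      field_simp
    · rw [Real.sq_sqrt (by positivity)]
      -- The exponent has slack, 2 · 16 ≥ 5², and the resulting probability δ/4 is below δ.
      have e : -(2 * T * (16 * Real.log (4 / δ) / T) / (3 + 2) ^ 2) ≤ -Real.log (4 / δ) := by
        rw [neg_le_neg_iff, show 2 * T * (16 * Real.log (4 / δ) / T) / (3 + 2) ^ 2
          = 32 / 25 * Real.log (4 / δ) by field_simp; ring]
        linarith
      refine (Real.exp_le_exp.2 e).trans ?_
      rw [Real.exp_neg, Real.exp_log (div_pos (by norm_num) hδ.1), inv_div]
      linarith [hδ.1]
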